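/- Let $M$ be a smooth Hausdorff surface and let $E\to M$ be a smooth real vector bundle of rank $4$ equipped with a smooth nondegenerate symmetric metric $\langle\,,\rangle$, a smooth bundle endomorphism $J$ with $J^2=-1$ and $\langle Jv,Jw\rangle=\langle v,w\rangle$, the metric being of complex index one (real signature $(2,2)$), a smooth connection $\tilde\nabla$ with $\tilde\nabla\langle\,,\rangle=0$ and $\tilde\nabla J=0$, and a smooth bundle map $\iota:TM\to E$ with $\tilde\nabla_X\iota Y-\tilde\nabla_Y\iota X=\iota[X,Y]$ for which the induced metric $g=\langle\iota\cdot,\iota\cdot\rangle$ on $M$ is Lorentzian. (For a Lorentzian surface $f:M\to\tilde M^2_1$ immersed in a Lorentzian Kähler surface, take $E=f^*T\tilde M^2_1$ with the pulled back metric, complex structure and Levi-Civita connection, and $\iota=df$.) Omit $\iota$ from the notation, and let ${}^\top,{}^\perp$ be the tangential and normal components. Define $\nabla,h,A,D$ by the formulas of Gauss and Weingarten, $$\tilde\nabla_XY=\nabla_XY+h(X,Y),\qquad \tilde\nabla_X\xi=-A_\xi X+D_X\xi$$ for $X,Y$ tangent and $\xi$ normal; let $R,R^D$ be the curvature tensors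 of $\nabla,D$, and put $(\bar\nabla_Xh)(Y,Z)=D_Xh(Y,Z)-h(\nabla_XY,Z)-h(Y,\nabla_XZ)$. For $c\in\mathbb R$ let $$\tilde R(X,Y)Z=c\{\langle Y,Z\rangle X-\langle X,Z\rangle Y+\langle JY,Z\rangle JX-\langle JX,Z\rangle JY+2\langle X,JY\rangle JZ\}$$ be the curvature tensor of a Lorentzian complex space form $\tilde M^2_1(4c)$. The equations of Gauss, Codazzi and Ricci of a surface in $\tilde M^2_1(4c)$ are $$\langle R(X,Y)Z,W\rangle=\langle\tilde R(X,Y)Z,W\rangle+\langle h(X,W),h(Y,Z)\rangle-\langle h(X,Z),h(Y,W)\rangle,$$ $$(\tilde R(X,Y)Z)^\perp=(\bar\nabla_Xh)(Y,Z)-(\bar\nabla_Yh)(X,Z),$$ $$\langle R^D(X,Y)\xi,\eta\rangle=\langle\tilde R(X,Y)\xi,\eta\rangle+\langle[A_\xi,A_\eta]X,Y\rangle$$ for $X,Y,Z,W$ tangent and $\xi,\eta$ normal to $M$. They are regarded as conditions on the above data: the curvature of $\tilde\nabla$ is not assumed to be $\tilde R$. Assume that $M$ is minimal ($H=\frac12\operatorname{trace}h=0$)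 and flat ($R=0$). Then: (1) The equation of Ricci is a consequence of the equations of Gauss and Codazzi: at every point of $M$ at which the equations of Gauss and Codazzi hold, the equation of Ricci holds. (2) Let $e_1,e_2$ be smooth vector fields on an open set $U\subset M$ with $\langle e_1,e_1\rangle=\langle e_2,e_2\rangle=0$, $\langle e_1,e_2\rangle=-1$ and $\nabla e_1=\nabla e_2=0$ (for example $e_1=\partial/\partial x$, $e_2=\partial/\partial y$ for local coordinates with $g=-dx\otimes dy-dy\otimes dx$), write $f_x=e_1f$, $f_y=e_2f$ and $f_{xy}=e_2(e_1f)$ for a function $f$, and define the Wirtinger angle $\alpha$ on $U$ by $\sinh\alpha=-\langle Je_1,e_2\rangle$. Then $\alpha$ is smooth on $U$, $(Je_1)^\top=(\sinh\alpha)e_1$, $(Je_2)^\top=-(\sinh\alpha)e_2$, and with $e_3=(\operatorname{sech}\alpha)(Je_1)^\perp$, $e_4=(\operatorname{sech}\alpha)(Je_2)^\perp$ there are functions $\beta,\gamma,\lambda,\mu$ on $U$ such that $$h(e_1,e_1)=\beta e_3+\gamma e_4,\qquad h(e_1,e_2)=0,\qquad h(e_2,e_2)=\lambda e_3+\mu e_4.$$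 At every point of $U$ the equation of Codazzi implies $$\alpha_{xy}=\alpha_x\alpha_y\tanh\alpha+3c\sinh\alpha\cosh\alpha,$$ and the equation of Gauss is equivalent to $$\gamma\lambda=\alpha_x\alpha_y+c(3\sinh^2\alpha-1).$$ -/

import Mathlib

open Bundle Manifold
open scoped ContDiff Topology

noncomputable section

/-- The model fibre of a real vector bundle of rank four. -/
abbrev R4 : Type := EuclideanSpace ℝ (Fin 4)

/-- The vector field `X` on the surface `M` is smooth on `U`. -/
def SmoothFieldOn {M : Type*} [TopologicalSpace M] [ChartedSpace (EuclideanSpace ℝ (Fin 2)) M]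
    [IsManifold (𝓡 2) ∞ M] (X : ∀ x : M, TangentSpace (𝓡 2) x) (U : Set M) : Prop :=
  ContMDiffOn (𝓡 2) ((𝓡 2).prod 𝓘(ℝ, EuclideanSpace ℝ (Fin 2))) ∞
    (fun x ↦ TotalSpace.mk' (EuclideanSpace ℝ (Fin 2)) x (X x)) U

/-- The vector field `X` on the surface `M` is smooth. -/
def SmoothField {M : Type*} [TopologicalSpace M] [ChartedSpace (EuclideanSpace ℝ (Fin 2)) M]
    [IsManifold (𝓡 2) ∞ M] (X : ∀ x : M, TangentSpace (𝓡 2) x) : Prop :=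
  ContMDiff (𝓡 2) ((𝓡 2).prod 𝓘(ℝ, EuclideanSpace ℝ (Fin 2))) ∞
    (fun x ↦ TotalSpace.mk' (EuclideanSpace ℝ (Fin 2)) x (X x))

/-- The vector field `X` on the surface `M` is differentiable at `x`. -/
def DiffFieldAt {M : Type*} [TopologicalSpace M] [ChartedSpace (EuclideanSpace ℝ (Fin 2)) M]
    [IsManifold (𝓡 2) ∞ M] (X : ∀ x : M, TangentSpace (𝓡 2) x) (x : M) : Prop :=
  MDifferentiableAt (𝓡 2) ((𝓡 2).prod 𝓘(ℝ, EuclideanSpace ℝ (Fin 2)))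
    (fun y ↦ TotalSpace.mk' (EuclideanSpace ℝ (Fin 2)) y (X y)) x

/-- The section `σ` of the rank four bundle `E` over `M` is smooth. -/
def SmoothSec {M : Type*} [TopologicalSpace M] [ChartedSpace (EuclideanSpace ℝ (Fin 2)) M]
    {E : M → Type*} [TopologicalSpace (TotalSpace R4 E)] [∀ x, TopologicalSpace (E x)]
    [FiberBundle R4 E] (σ : ∀ x, E x) : Prop :=
  ContMDiff (𝓡 2) ((𝓡 2).prod 𝓘(ℝ, R4)) ∞ (fun x ↦ TotalSpace.mk' R4 x (σ x))

/-- The section `σ` of the rank four bundle `E` over `M` is differentiable at `x`. -/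
def DiffSecAt {M : Type*} [TopologicalSpace M] [ChartedSpace (EuclideanSpace ℝ (Fin 2)) M]
    {E : M → Type*} [TopologicalSpace (TotalSpace R4 E)] [∀ x, TopologicalSpace (E x)]
    [FiberBundle R4 E] (σ : ∀ x, E x) (x : M) : Prop :=
  MDifferentiableAt (𝓡 2) ((𝓡 2).prod 𝓘(ℝ, R4)) (fun y ↦ TotalSpace.mk' R4 y (σ y)) x

/-- A Lorentzian surface in a Lorentzian Kähler surface, described along the surface `M`.

`E` is the tangent bundle of the ambient Kähler surface along `M`: for an immersion `f : M → M̃`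
it is the pullback bundle `f^* TM̃`, with the pulled back metric `⟨ , ⟩`, complex structure `J` and
Levi-Civita connection `∇̃`, and `ι` is the differential of `f`.
Nothing is assumed on the curvature of `∇̃`, so that the equations of Gauss, Codazzi and Ricci
are independent conditions on these data. -/
structure LorentzianSurface
    (M : Type*) [TopologicalSpace M] [ChartedSpace (EuclideanSpace ℝ (Fin 2)) M]
    [IsManifold (𝓡 2) ∞ M]
    (E : M → Type*) [TopologicalSpace (TotalSpace R4 E)] [∀ x, AddCommGroup (E x)]
    [∀ x, Module ℝ (E x)] [∀ x, TopologicalSpace (E x)] [∀ x, IsTopologicalAddGroup (E x)]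
    [∀ x, ContinuousSMul ℝ (E x)] [FiberBundle R4 E] [VectorBundle ℝ R4 E]
    [ContMDiffVectorBundle ∞ R4 E (𝓡 2)] where
  /-- The ambient metric. -/
  metric : ∀ x, E x →L[ℝ] E x →L[ℝ] ℝ
  metric_contMDiff : ContMDiff (𝓡 2) ((𝓡 2).prod 𝓘(ℝ, R4 →L[ℝ] R4 →L[ℝ] ℝ)) ∞
    (fun x ↦ TotalSpace.mk' (R4 →L[ℝ] R4 →L[ℝ] ℝ) x (metric x))
  metric_symm : ∀ x v w, metric x v w = metric x w v
  /-- The complex structure. -/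
  J : ∀ x, E x →L[ℝ] E x
  J_contMDiff : ContMDiff (𝓡 2) ((𝓡 2).prod 𝓘(ℝ, R4 →L[ℝ] R4)) ∞
    (fun x ↦ TotalSpace.mk' (R4 →L[ℝ] R4) x (J x))
  J_sq : ∀ x v, J x (J x v) = -v
  J_isometry : ∀ x v w, metric x (J x v) (J x w) = metric x v w
  /-- The ambient metric is nondegenerate of complex index one: `u, Ju, v, Jv` is an
  orthogonal basis on which it takes the values `-1, -1, 1, 1`. -/
  complex_index_one : ∀ x, ∃ u v : E x, metric x u u = -1 ∧ metric x v v = 1 ∧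
    metric x u v = 0 ∧ metric x u (J x v) = 0
  /-- The ambient Levi-Civita connection along the surface;
  `conn σ x u` is `∇̃_u σ` at the point `x`. -/
  conn : CovariantDerivative (𝓡 2) R4 E
  conn_contMDiff : CovariantDerivative.ContMDiffCovariantDerivative conn ∞
  conn_metric : ∀ (x : M) (σ τ : ∀ y, E y), DiffSecAt σ x → DiffSecAt τ x →
    ∀ u : TangentSpace (𝓡 2) x,
      mvfderiv (𝓡 2) (fun y ↦ metric y (σ y) (τ y)) x u =
        metric x (conn σ x u) (τ x) + metric x (σ x) (conn τ x u)
  /-- The Kähler condition `∇̃ J = 0`. -/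
  conn_J : ∀ (x : M) (σ : ∀ y, E y), DiffSecAt σ x → ∀ u : TangentSpace (𝓡 2) x,
    conn (fun y ↦ J y (σ y)) x u = J x (conn σ x u)
  /-- The differential of the immersion. -/
  ι : ∀ x, TangentSpace (𝓡 2) x →L[ℝ] E x
  ι_contMDiff : ContMDiff (𝓡 2) ((𝓡 2).prod 𝓘(ℝ, EuclideanSpace ℝ (Fin 2) →L[ℝ] R4)) ∞
    (fun x ↦ TotalSpace.mk' (EuclideanSpace ℝ (Fin 2) →L[ℝ] R4)
      (E := fun x ↦ TangentSpace (𝓡 2) x →L[ℝ] E x) x (ι x))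
  /-- The ambient connection has no torsion: `∇̃_X Y - ∇̃_Y X = [X, Y]`. -/
  torsion_free : ∀ (x : M) (X Y : ∀ y : M, TangentSpace (𝓡 2) y),
    DiffFieldAt X x → DiffFieldAt Y x →
    conn (fun y ↦ ι y (Y y)) x (X x) - conn (fun y ↦ ι y (X y)) x (Y x) =
      ι x (VectorField.mlieBracket (𝓡 2) X Y x)
  /-- The induced metric is Lorentzian. In particular `ι x` is injective. -/
  lorentzian : ∀ x, ∃ u v : TangentSpace (𝓡 2) x, metric x (ι x u) (ι x u) = -1 ∧
    metric x (ι x v) (ι x v) = 1 ∧ metric x (ι x u) (ι x v) = 0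

namespace LorentzianSurface

variable {M : Type*} [TopologicalSpace M] [ChartedSpace (EuclideanSpace ℝ (Fin 2)) M]
  [IsManifold (𝓡 2) ∞ M]
  {E : M → Type*} [TopologicalSpace (TotalSpace R4 E)] [∀ x, AddCommGroup (E x)]
  [∀ x, Module ℝ (E x)] [∀ x, TopologicalSpace (E x)] [∀ x, IsTopologicalAddGroup (E x)]
  [∀ x, ContinuousSMul ℝ (E x)] [FiberBundle R4 E] [VectorBundle ℝ R4 E]
  [ContMDiffVectorBundle ∞ R4 E (𝓡 2)]
  (S : LorentzianSurface M E)

instance (x : M) : FiniteDimensional ℝ (TangentSpace (𝓡 2) x) :=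
  inferInstanceAs (FiniteDimensional ℝ (EuclideanSpace ℝ (Fin 2)))

/-- The induced metric `g` of the surface. -/
def g (x : M) : LinearMap.BilinForm ℝ (TangentSpace (𝓡 2) x) :=
  LinearMap.mk₂ ℝ (fun u v ↦ S.metric x (S.ι x u) (S.ι x v))
    (by intros; simp) (by intros; simp) (by intros; simp) (by intros; simp)

theorem g_apply (x : M) (u v : TangentSpace (𝓡 2) x) :
    S.g x u v = S.metric x (S.ι x u) (S.ι x v) := rfl

theorem g_nondegenerate (x : M) : (S.g x).Nondegenerate := by
  obtain ⟨u, v, hu, hv, huv⟩ := S.lorentzian x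
  have huv' : S.metric x (S.ι x v) (S.ι x u) = 0 := by rw [S.metric_symm]; exact huv
  have hli : LinearIndependent ℝ ![u, v] := by
    rw [LinearIndependent.pair_iff]
    intro a b hab
    have h1 : S.g x (a • u + b • v) u = 0 := by rw [hab]; simp
    have h2 : S.g x (a • u + b • v) v = 0 := by rw [hab]; simp
    simp [g_apply, hu, huv'] at h1
    simp [g_apply, hv, huv] at h2
    exact ⟨h1, h2⟩
  have hspan : ∀ w : TangentSpace (𝓡 2) x, ∃ a b : ℝ, a • u + b • v = w := by
    intro w
    have hcard : Fintype.card (Fin 2) = Module.finrank ℝ (TangentSpace (𝓡 2) x) := by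
      change _ = Module.finrank ℝ (EuclideanSpace ℝ (Fin 2))
      simp
    have htop := hli.span_eq_top_of_card_eq_finrank' hcard
    have hw : w ∈ Submodule.span ℝ (Set.range ![u, v]) := by rw [htop]; trivial
    rw [Matrix.range_cons, Matrix.range_cons, Matrix.range_empty, Set.union_empty,
      Set.singleton_union, Submodule.mem_span_pair] at hw
    exact hw
  have key : ∀ w : TangentSpace (𝓡 2) x, S.g x w u = 0 → S.g x w v = 0 → w = 0 := by
    intro w h1 h2
    obtain ⟨a, b, rfl⟩ := hspan w
    simp [g_apply, hu, huv'] at h1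
    simp [g_apply, hv, huv] at h2
    simp [h1, h2]
  refine ⟨fun w hw ↦ key w (hw u) (hw v), fun w hw ↦ key w ?_ ?_⟩
  · rw [g_apply, S.metric_symm]; exact hw u
  · rw [g_apply, S.metric_symm]; exact hw v

/-- The tangential component `w^⊤` of an ambient vector, as a tangent vector of `M`. -/
def tang (x : M) (w : E x) : TangentSpace (𝓡 2) x :=
  ((S.g x).toDual (S.g_nondegenerate x)).symm
    ((S.metric x w : E x →ₗ[ℝ] ℝ) ∘ₗ (S.ι x : TangentSpace (𝓡 2) x →ₗ[ℝ] E x))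

theorem g_tang (x : M) (w : E x) (u : TangentSpace (𝓡 2) x) :
    S.g x (S.tang x w) u = S.metric x w (S.ι x u) :=
  LinearMap.BilinForm.apply_toDual_symm_apply (B := S.g x) (hB := S.g_nondegenerate x)
    ((S.metric x w : E x →ₗ[ℝ] ℝ) ∘ₗ (S.ι x : TangentSpace (𝓡 2) x →ₗ[ℝ] E x)) u

/-- The normal component `w^⊥` of an ambient vector. -/
def nor (x : M) (w : E x) : E x := w - S.ι x (S.tang x w)

theorem metric_nor_ι (x : M) (w : E x) (u : TangentSpace (𝓡 2) x) :
    S.metric x (S.nor x w) (S.ι x u) = 0 := by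
  have := S.g_tang x w u
  rw [g_apply] at this
  simp [nor, this]

/-- `ξ` is a normal vector field. -/
def IsNormal (ξ : ∀ x, E x) : Prop := ∀ x u, S.metric x (ξ x) (S.ι x u) = 0

/-- The Levi-Civita connection `∇_u Y` of `M`: the tangential part in the formula of Gauss. -/
def nabla (Y : ∀ x : M, TangentSpace (𝓡 2) x) (x : M) (u : TangentSpace (𝓡 2) x) :
    TangentSpace (𝓡 2) x :=
  S.tang x (S.conn (fun y ↦ S.ι y (Y y)) x u)

/-- The second fundamental form `h(X, Y)`: the normal part in the formula of Gauss. -/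
def h (X Y : ∀ x : M, TangentSpace (𝓡 2) x) (x : M) : E x :=
  S.nor x (S.conn (fun y ↦ S.ι y (Y y)) x (X x))

/-- The shape operator `A_ξ X`: minus the tangential part in the formula of Weingarten. -/
def shape (ξ : ∀ x, E x) (X : ∀ x : M, TangentSpace (𝓡 2) x) (x : M) : TangentSpace (𝓡 2) x :=
  -S.tang x (S.conn ξ x (X x))

/-- The normal connection `D_u ξ`: the normal part in the formula of Weingarten. -/
def normalConn (ξ : ∀ x, E x) (x : M) (u : TangentSpace (𝓡 2) x) : E x :=
  S.nor x (S.conn ξ x u)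

/-- The curvature tensor `R(X, Y)Z = ∇_X ∇_Y Z - ∇_Y ∇_X Z - ∇_[X,Y] Z` of `M`. -/
def R (X Y Z : ∀ x : M, TangentSpace (𝓡 2) x) (x : M) : TangentSpace (𝓡 2) x :=
  S.nabla (fun y ↦ S.nabla Z y (Y y)) x (X x) - S.nabla (fun y ↦ S.nabla Z y (X y)) x (Y x)
    - S.nabla Z x (VectorField.mlieBracket (𝓡 2) X Y x)

/-- The normal curvature tensor `R^D(X, Y)ξ`. -/
def RD (X Y : ∀ x : M, TangentSpace (𝓡 2) x) (ξ : ∀ x, E x) (x : M) : E x :=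
  S.normalConn (fun y ↦ S.normalConn ξ y (Y y)) x (X x)
    - S.normalConn (fun y ↦ S.normalConn ξ y (X y)) x (Y x)
    - S.normalConn ξ x (VectorField.mlieBracket (𝓡 2) X Y x)

/-- `(∇̄_X h)(Y, Z) = D_X h(Y, Z) - h(∇_X Y, Z) - h(Y, ∇_X Z)`. -/
def nablaBarH (X Y Z : ∀ x : M, TangentSpace (𝓡 2) x) (x : M) : E x :=
  S.normalConn (S.h Y Z) x (X x) - S.h (fun y ↦ S.nabla Y y (X y)) Z x
    - S.h Y (fun y ↦ S.nabla Z y (X y)) x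

/-- The curvature tensor of a complex space form of constant holomorphic sectional
curvature `4c`. -/
def Rtilde (c : ℝ) (x : M) (X Y Z : E x) : E x :=
  c • (S.metric x Y Z • X - S.metric x X Z • Y + S.metric x (S.J x Y) Z • S.J x X
    - S.metric x (S.J x X) Z • S.J x Y + (2 * S.metric x X (S.J x Y)) • S.J x Z)

/-- The mean curvature vector `H = (1/2) trace h`, the trace being taken with respect to `g`. -/
def meanCurvature (x : M) : E x :=
  let b : Module.Basis (Fin 2) ℝ (TangentSpace (𝓡 2) x) :=
    (EuclideanSpace.basisFun (Fin 2) ℝ).toBasis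
  (1 / 2 : ℝ) • ∑ i, S.h (FiberBundle.extend (EuclideanSpace ℝ (Fin 2)) (b i))
    (FiberBundle.extend (EuclideanSpace ℝ (Fin 2))
      ((S.g x).dualBasis (S.g_nondegenerate x) b i)) x

def IsMinimal : Prop := ∀ x, S.meanCurvature x = 0

def IsFlat : Prop := ∀ X Y Z : ∀ x : M, TangentSpace (𝓡 2) x,
  SmoothField X → SmoothField Y → SmoothField Z → ∀ x, S.R X Y Z x = 0

/-- The equation of Gauss at the point `x` for the ambient curvature tensor `Rtilde c`. -/
def GaussAt (c : ℝ) (x : M) : Prop := ∀ X Y Z W : ∀ x : M, TangentSpace (𝓡 2) x,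
  SmoothField X → SmoothField Y → SmoothField Z → SmoothField W →
    S.g x (S.R X Y Z x) (W x) =
      S.metric x (S.Rtilde c x (S.ι x (X x)) (S.ι x (Y x)) (S.ι x (Z x))) (S.ι x (W x))
        + S.metric x (S.h X W x) (S.h Y Z x) - S.metric x (S.h X Z x) (S.h Y W x)

/-- The equation of Codazzi at the point `x` for the ambient curvature tensor `Rtilde c`. -/
def CodazziAt (c : ℝ) (x : M) : Prop := ∀ X Y Z : ∀ x : M, TangentSpace (𝓡 2) x,
  SmoothField X → SmoothField Y → SmoothField Z →
    S.nor x (S.Rtilde c x (S.ι x (X x)) (S.ι x (Y x)) (S.ι x (Z x))) =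
      S.nablaBarH X Y Z x - S.nablaBarH Y X Z x

/-- The equation of Ricci at the point `x` for the ambient curvature tensor `Rtilde c`. -/
def RicciAt (c : ℝ) (x : M) : Prop :=
  ∀ (X Y : ∀ x : M, TangentSpace (𝓡 2) x) (ξ η : ∀ x, E x),
  SmoothField X → SmoothField Y → SmoothSec ξ → SmoothSec η →
  S.IsNormal ξ → S.IsNormal η →
    S.metric x (S.RD X Y ξ x) (η x) =
      S.metric x (S.Rtilde c x (S.ι x (X x)) (S.ι x (Y x)) (ξ x)) (η x)
        + S.g x (S.shape ξ (S.shape η X) x - S.shape η (S.shape ξ X) x) (Y x)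

/-- `e₁, e₂` is a pseudo-orthonormal frame with `∇e₁ = ∇e₂ = 0` on the open set `U`, such as
`∂/∂x, ∂/∂y` for coordinates in which the metric of `M` is `-dx ⊗ dy - dy ⊗ dx`. -/
structure IsParallelNullFrame (U : Set M) (e₁ e₂ : ∀ x : M, TangentSpace (𝓡 2) x) : Prop where
  isOpen : IsOpen U
  contMDiffOn_fst : SmoothFieldOn e₁ U
  contMDiffOn_snd : SmoothFieldOn e₂ U
  null_fst : ∀ x ∈ U, S.g x (e₁ x) (e₁ x) = 0
  null_snd : ∀ x ∈ U, S.g x (e₂ x) (e₂ x) = 0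
  pairing : ∀ x ∈ U, S.g x (e₁ x) (e₂ x) = -1
  parallel_fst : ∀ x ∈ U, ∀ u, S.nabla e₁ x u = 0
  parallel_snd : ∀ x ∈ U, ∀ u, S.nabla e₂ x u = 0

/-- The tangential component `PX` of `JX`. -/
def P (x : M) (u : TangentSpace (𝓡 2) x) : TangentSpace (𝓡 2) x := S.tang x (S.J x (S.ι x u))

/-- The normal component `FX` of `JX`. -/
def F (x : M) (u : TangentSpace (𝓡 2) x) : E x := S.nor x (S.J x (S.ι x u))

/-- The Wirtinger angle `α` of the pseudo-orthonormal frame `e₁, e₂`, given by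
`sinh α = -⟨P e₁, e₂⟩`. -/
def wirtingerAngle (e₁ e₂ : ∀ x : M, TangentSpace (𝓡 2) x) (x : M) : ℝ :=
  Real.arsinh (-S.g x (S.P x (e₁ x)) (e₂ x))

/-- The normal fields `e₃ = (sech α) F e₁` (for `e = e₁`) and `e₄ = (sech α) F e₂`
(for `e = e₂`) of the adapted frame with Wirtinger angle `α`. -/
def adaptedNormal (α : M → ℝ) (e : ∀ x : M, TangentSpace (𝓡 2) x) (x : M) : E x :=
  (Real.cosh (α x))⁻¹ • S.F x (e x)

end LorentzianSurface

/-- The derivative `X f` of a function along a vector field. -/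
def dirDeriv {M : Type*} [TopologicalSpace M] [ChartedSpace (EuclideanSpace ℝ (Fin 2)) M]
    (X : ∀ x : M, TangentSpace (𝓡 2) x) (f : M → ℝ) (x : M) : ℝ :=
  mvfderiv (𝓡 2) f x (X x)

end

/-! ### Smooth and differentiable sections, global extension of germs, and the bracket as a
commutator. -/

section Regularity

variable {M : Type*} [TopologicalSpace M] [ChartedSpace (EuclideanSpace ℝ (Fin 2)) M]

/-! Ricci from Gauss and Codazzi. Let `K` be the curvature of the ambient connection along the
surface (`ambientCurvature`). Splitting second derivatives into tangential and normal parts gives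
the three fundamental equations with `K` in place of `Rtilde` (`g_R`, `nor_ambientCurvature`,
`metric_RD`). So Gauss and Codazzi together say that `K` and `Rtilde` agree on tangent vectors, and
Ricci asks for agreement on normal vectors. Both commute with `J` (`ambientCurvature_J`,
`Rtilde_J`), and `K` is pointwise in the section it acts on (`ambientCurvature_congr`). For a null
basis `a, b` of the tangent plane, `a, b, Ja, Jb` is always a basis of the fibre, because `1 + sinh²
α` never vanishes; hence every normal vector is `Ju - v` with `u, v` tangent (`exists_eq_F`), and
the agreement carries over.

The Wirtinger angle. For a parallel null frame the ambient derivative of `e₁, e₂` is just `h`, so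
`∇̃J = 0` expresses the derivatives of `sinh α` through `h` and `J` (`dirDeriv_sinhAngle`).
Minimality means `h(e₁, e₂) = 0`, and then `β = -α_x`, `μ = α_y` (`h_fst_fst`, `h_snd_snd`). In
dimension two Gauss is one scalar equation (`gaussAt_iff`); expanding `⟨h(e₁,e₁), h(e₂,e₂)⟩ = -(βμ +
γλ)` gives the formula for `γλ`. Codazzi gives `D_{e₂} h(e₁,e₁) = -3c sinh α · Fe₁`
(`exists_normal_germ`); differentiating `cosh α · α_x = ⟨h(e₁,e₁), Je₂⟩` along `e₂` then gives the
equation for `α_xy`, the terms in `γλ` cancelling (`dirDeriv_dirDeriv`). -/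

theorem SmoothSec.diffSecAt {E : M → Type*} [TopologicalSpace (TotalSpace R4 E)]
    [∀ x, TopologicalSpace (E x)] [FiberBundle R4 E]
    {σ : ∀ x : M, E x} (hσ : SmoothSec σ) (x : M) : DiffSecAt σ x :=
  ContMDiff.mdifferentiable hσ (by simp) x

theorem DiffSecAt.sub {E : M → Type*} [TopologicalSpace (TotalSpace R4 E)]
    [∀ x, AddCommGroup (E x)] [∀ x, Module ℝ (E x)] [∀ x, TopologicalSpace (E x)]
    [FiberBundle R4 E] [VectorBundle ℝ R4 E] {σ τ : ∀ x : M, E x} {x : M}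
    (hσ : DiffSecAt σ x) (hτ : DiffSecAt τ x) : DiffSecAt (fun y ↦ σ y - τ y) x :=
  mdifferentiableAt_sub_section hσ hτ

variable [IsManifold (𝓡 2) ∞ M]

theorem SmoothField.diffFieldAt {X : ∀ x : M, TangentSpace (𝓡 2) x} (hX : SmoothField X) (x : M) :
    DiffFieldAt X x :=
  ContMDiff.mdifferentiable hX (by simp) x

theorem SmoothFieldOn.diffFieldAt {X : ∀ x : M, TangentSpace (𝓡 2) x} {U : Set M}
    (hX : SmoothFieldOn X U) (hU : IsOpen U) {x : M} (hx : x ∈ U) : DiffFieldAt X x :=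
  (ContMDiffOn.contMDiffAt hX (hU.mem_nhds hx)).mdifferentiableAt (by simp)

/-- A vector field that is smooth near a point has the germ of a global smooth vector field. -/
theorem SmoothFieldOn.exists_smoothField_eventuallyEq [T2Space M]
    {X : ∀ x : M, TangentSpace (𝓡 2) x} {U : Set M}
    (hX : SmoothFieldOn X U) (hU : IsOpen U) {x : M} (hx : x ∈ U) :
    ∃ X' : ∀ x : M, TangentSpace (𝓡 2) x, SmoothField X' ∧ ∀ᶠ y in 𝓝 x, X' y = X y := by
  obtain ⟨f, -, hf⟩ := (SmoothBumpFunction.nhds_basis_tsupport (I := 𝓡 2) x).mem_iff.1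
    (hU.mem_nhds hx)
  refine ⟨fun y ↦ f y • X y, ?_, ?_⟩
  · exact ContMDiffOn.smul_section_of_tsupport (u := U) (ψ := f) f.contMDiff.contMDiffOn hU hf hX
  · filter_upwards [f.eventuallyEq_one] with y hy
    simp [hy]

/-- Every tangent vector is a value of a global smooth vector field. -/
theorem exists_smoothField_apply_eq [T2Space M] {x : M} (v : TangentSpace (𝓡 2) x) :
    ∃ X : ∀ x : M, TangentSpace (𝓡 2) x, SmoothField X ∧ X x = v := by
  obtain ⟨U, hU, hX⟩ := FiberBundle.exists_contMDiffOn_extend (I := 𝓡 2) (k := ∞)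
    (F := EuclideanSpace ℝ (Fin 2)) v
  obtain ⟨V, hVU, hV, hxV⟩ := mem_nhds_iff.1 hU
  obtain ⟨X, hXs, hXe⟩ := SmoothFieldOn.exists_smoothField_eventuallyEq
    (X := FiberBundle.extend (EuclideanSpace ℝ (Fin 2)) v) (U := V) (hX.mono hVU) hV hxV
  exact ⟨X, hXs, by rw [hXe.self_of_nhds]; simp⟩

/-- The Lie bracket of vector fields acts on functions as the commutator of derivations. -/
theorem dirDeriv_mlieBracket [T2Space M] {X Y : ∀ x : M, TangentSpace (𝓡 2) x} {f : M → ℝ}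
    (hX : SmoothField X) (hY : SmoothField Y) (hf : ContMDiff (𝓡 2) 𝓘(ℝ, ℝ) ∞ f) {x : M}
    (hXf : MDifferentiableAt (𝓡 2) 𝓘(ℝ, ℝ) (dirDeriv X f) x)
    (hYf : MDifferentiableAt (𝓡 2) 𝓘(ℝ, ℝ) (dirDeriv Y f) x) :
    dirDeriv (VectorField.mlieBracket (𝓡 2) X Y) f x =
      dirDeriv X (dirDeriv Y f) x - dirDeriv Y (dirDeriv X f) x := by
  have h3 : (3 : WithTop ℕ∞) ≤ ∞ := WithTop.coe_le_coe.2 (le_top : (3 : ℕ∞) ≤ ⊤)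
  have h2 : (2 : WithTop ℕ∞) ≤ ∞ := WithTop.coe_le_coe.2 (le_top : (2 : ℕ∞) ≤ ⊤)
  have : IsManifold (𝓡 2) (minSmoothness ℝ 3) M := IsManifold.of_le (n := ∞) (by
    rw [minSmoothness_of_isRCLikeNormedField]; exact h3)
  have : IsManifold (𝓡 2) 3 M := IsManifold.of_le (n := ∞) h3
  have : IsManifold (𝓡 2) ((2 : ℕ∞) + 1) M :=
    IsManifold.of_le (n := ∞) (by exact_mod_cast le_top)
  have : IsManifold (𝓡 2) (minSmoothness ℝ 2) M := IsManifold.of_le (n := ∞) (by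
    rw [minSmoothness_of_isRCLikeNormedField]; exact h2)
  -- The formula is extracted from the Jacobi identity: the identity for `X, Y, f • W`, minus `f`
  -- times the one for `X, Y, W`, leaves a multiple of `W x`. Any field with `W x ≠ 0` serves.
  obtain ⟨W, hW, hWx⟩ := exists_smoothField_apply_eq (x := x)
    (EuclideanSpace.single 0 1 : EuclideanSpace ℝ (Fin 2))
  have hW0 : W x ≠ 0 := by
    rw [hWx]
    change (EuclideanSpace.single 0 1 : EuclideanSpace ℝ (Fin 2)) ≠ 0
    simp
  have hfd : MDifferentiable (𝓡 2) 𝓘(ℝ, ℝ) f := hf.mdifferentiable (by simp)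
  have two_le : ∀ {Z : ∀ x : M, TangentSpace (𝓡 2) x}, SmoothField Z →
      ∀ y, ContMDiffAt (𝓡 2) ((𝓡 2).prod 𝓘(ℝ, EuclideanSpace ℝ (Fin 2))) (minSmoothness ℝ 2)
        (fun y ↦ TotalSpace.mk' (EuclideanSpace ℝ (Fin 2)) y (Z y)) y := fun hZ y ↦
    (ContMDiff.contMDiffAt hZ).of_le (by
      rw [minSmoothness_of_isRCLikeNormedField]; exact h2)
  have hbr : ∀ {Z Z' : ∀ x : M, TangentSpace (𝓡 2) x}, SmoothField Z → SmoothField Z' →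
      DiffFieldAt (VectorField.mlieBracket (𝓡 2) Z Z') x := fun hZ hZ' ↦
    (ContMDiffAt.mlieBracket_vectorField (m := 1) (n := 2)
      ((ContMDiff.contMDiffAt hZ).of_le (by exact_mod_cast le_top))
      ((ContMDiff.contMDiffAt hZ').of_le (by exact_mod_cast le_top))
      (by rw [minSmoothness_of_isRCLikeNormedField]; norm_num)).mdifferentiableAt (by simp)
  have hfW : SmoothField (f • W) := ContMDiff.smul_section hf hW
  have leib : ∀ Z : ∀ x : M, TangentSpace (𝓡 2) x, VectorField.mlieBracket (𝓡 2) Z (f • W) =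
      dirDeriv Z f • W + f • VectorField.mlieBracket (𝓡 2) Z W := fun Z ↦ by
    ext1 y
    exact VectorField.mlieBracket_smul_right (hfd y) (hW.diffFieldAt y)
  have leib₂ : ∀ {Z Z' : ∀ x : M, TangentSpace (𝓡 2) x}, SmoothField Z' →
      MDifferentiableAt (𝓡 2) 𝓘(ℝ, ℝ) (dirDeriv Z' f) x →
      VectorField.mlieBracket (𝓡 2) Z (VectorField.mlieBracket (𝓡 2) Z' (f • W)) x =
      (dirDeriv Z (dirDeriv Z' f) x • W x + dirDeriv Z' f x • VectorField.mlieBracket (𝓡 2) Z W x)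
      + (dirDeriv Z f x • VectorField.mlieBracket (𝓡 2) Z' W x
        + f x • VectorField.mlieBracket (𝓡 2) Z (VectorField.mlieBracket (𝓡 2) Z' W) x) := by
    intro Z Z' hZ' hd
    have h1 : DiffFieldAt W x := hW.diffFieldAt x
    have h2 := hbr hZ' hW
    rw [leib Z', VectorField.mlieBracket_add_right
      (MDifferentiableAt.smul_section hd h1) (MDifferentiableAt.smul_section (hfd x) h2),
      VectorField.mlieBracket_smul_right hd h1, VectorField.mlieBracket_smul_right (hfd x) h2]
    rfl
  have J₁ := VectorField.leibniz_identity_mlieBracket_apply (two_le hX x) (two_le hY x)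
    (two_le hW x)
  have J₂ := VectorField.leibniz_identity_mlieBracket_apply (two_le hX x) (two_le hY x)
    (two_le hfW x)
  rw [leib₂ hY hYf, leib₂ hX hXf, leib, Pi.add_apply, Pi.smul_apply', Pi.smul_apply', J₁] at J₂
  have key : (dirDeriv (VectorField.mlieBracket (𝓡 2) X Y) f x -
      (dirDeriv X (dirDeriv Y f) x - dirDeriv Y (dirDeriv X f) x)) • W x = 0 := by
    rw [← neg_eq_zero, ← sub_eq_zero.2 J₂]
    module
  rcases smul_eq_zero.1 key with h | h
  · exact sub_eq_zero.1 h
  · exact absurd h hW0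

end Regularity

namespace LorentzianSurface

variable {M : Type*} [TopologicalSpace M] [ChartedSpace (EuclideanSpace ℝ (Fin 2)) M]
  [IsManifold (𝓡 2) ∞ M]
  {E : M → Type*} [TopologicalSpace (TotalSpace R4 E)] [∀ x, AddCommGroup (E x)]
  [∀ x, Module ℝ (E x)] [∀ x, TopologicalSpace (E x)] [∀ x, IsTopologicalAddGroup (E x)]
  [∀ x, ContinuousSMul ℝ (E x)] [FiberBundle R4 E] [VectorBundle ℝ R4 E]
  [ContMDiffVectorBundle ∞ R4 E (𝓡 2)]
  (S : LorentzianSurface M E)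

/-! ### Linear algebra in one fibre. -/

section Pointwise

variable {x : M}

theorem g_symm (u v : TangentSpace (𝓡 2) x) : S.g x u v = S.g x v u := by
  rw [g_apply, g_apply, S.metric_symm]

theorem metric_J_left (v w : E x) : S.metric x (S.J x v) w = -S.metric x v (S.J x w) := by
  rw [← S.J_isometry x v, S.J_sq]; simp

theorem metric_J_self (v : E x) : S.metric x (S.J x v) v = 0 := by
  have h := S.metric_J_left v v
  rw [S.metric_symm x v] at h
  linarith

theorem metric_self_J (v : E x) : S.metric x v (S.J x v) = 0 := by
  rw [S.metric_symm, metric_J_self]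

theorem ι_tang_add_nor (w : E x) : S.ι x (S.tang x w) + S.nor x w = w := by
  simp [nor]

theorem eq_of_g_eq {t t' : TangentSpace (𝓡 2) x} (h : ∀ u, S.g x t u = S.g x t' u) : t = t' :=
  sub_eq_zero.1 <| (S.g_nondegenerate x).1 _ fun u ↦ by simp [h u]

theorem tang_eq {w : E x} {t : TangentSpace (𝓡 2) x}
    (h : ∀ u, S.g x t u = S.metric x w (S.ι x u)) : S.tang x w = t :=
  S.eq_of_g_eq fun u ↦ by rw [g_tang, h]

theorem tang_add (v w : E x) : S.tang x (v + w) = S.tang x v + S.tang x w :=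
  S.tang_eq fun u ↦ by simp [g_tang]

theorem tang_sub (v w : E x) : S.tang x (v - w) = S.tang x v - S.tang x w :=
  S.tang_eq fun u ↦ by simp [g_tang]

theorem tang_ι (u : TangentSpace (𝓡 2) x) : S.tang x (S.ι x u) = u :=
  S.tang_eq fun v ↦ S.g_apply x u v

theorem nor_add (v w : E x) : S.nor x (v + w) = S.nor x v + S.nor x w := by
  simp only [nor, tang_add, map_add]; abel

theorem nor_sub (v w : E x) : S.nor x (v - w) = S.nor x v - S.nor x w := by
  simp only [nor, tang_sub, map_sub]; abel

theorem nor_smul (a : ℝ) (w : E x) : S.nor x (a • w) = a • S.nor x w := by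
  have : S.tang x (a • w) = a • S.tang x w := S.tang_eq fun u ↦ by simp [g_tang]
  simp only [nor, this, map_smul, smul_sub]

theorem nor_ι (u : TangentSpace (𝓡 2) x) : S.nor x (S.ι x u) = 0 := by
  simp [nor, tang_ι]

theorem metric_nor_left_of_normal {w n : E x} (hn : ∀ u, S.metric x n (S.ι x u) = 0) :
    S.metric x (S.nor x w) n = S.metric x w n := by
  simp [nor, S.metric_symm x (S.ι x _), hn]

/-- A tangent vector is determined by its products with two vectors of nondegenerate Gram
matrix. -/
theorem ext_g_of_gram_ne_zero {a b t t' : TangentSpace (𝓡 2) x}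
    (h : S.g x a a * S.g x b b - S.g x a b ^ 2 ≠ 0)
    (ha : S.g x t a = S.g x t' a) (hb : S.g x t b = S.g x t' b) : t = t' := by
  have hba := S.g_symm b a
  have hli : LinearIndependent ℝ ![a, b] := by
    rw [LinearIndependent.pair_iff]
    intro p q hpq
    have h1 : S.g x (p • a + q • b) a = 0 := by rw [hpq]; simp
    have h2 : S.g x (p • a + q • b) b = 0 := by rw [hpq]; simp
    simp [hba] at h1
    simp at h2
    constructor
    · refine (mul_eq_zero.1 ?_).resolve_right h
      linear_combination S.g x b b * h1 - S.g x a b * h2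
    · refine (mul_eq_zero.1 ?_).resolve_right h
      linear_combination S.g x a a * h2 - S.g x a b * h1
  have hcard : Fintype.card (Fin 2) = Module.finrank ℝ (TangentSpace (𝓡 2) x) := by
    change _ = Module.finrank ℝ (EuclideanSpace ℝ (Fin 2))
    simp
  refine S.eq_of_g_eq fun u ↦ ?_
  have hu : u ∈ Submodule.span ℝ (Set.range ![a, b]) := by
    rw [hli.span_eq_top_of_card_eq_finrank' hcard]; trivial
  rw [Matrix.range_cons, Matrix.range_cons, Matrix.range_empty, Set.union_empty,
    Set.singleton_union, Submodule.mem_span_pair] at hu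
  obtain ⟨p, q, rfl⟩ := hu
  simp [ha, hb]

/-- The pair `a, b` is a pseudo-orthonormal basis of the tangent plane. -/
structure IsNullPair (a b : TangentSpace (𝓡 2) x) : Prop where
  null_fst : S.g x a a = 0
  null_snd : S.g x b b = 0
  pairing : S.g x a b = -1

variable (x) in
theorem exists_isNullPair : ∃ a b : TangentSpace (𝓡 2) x, S.IsNullPair a b := by
  obtain ⟨u, v, hu, hv, huv⟩ := S.lorentzian x
  rw [← g_apply] at hu hv huv
  have hvu := S.g_symm v u
  -- Light-cone vectors of a Lorentzian orthonormal pair; the factor `1/2` normalises their product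
  -- to `-1`.
  refine ⟨u + v, (1 / 2 : ℝ) • (u - v), ⟨?_, ?_, ?_⟩⟩ <;>
    norm_num [hu, hv, huv, hvu]

/-- The number `-⟨Ja, b⟩`, the hyperbolic sine of the Wirtinger angle. -/
noncomputable def sinhAngle (a b : TangentSpace (𝓡 2) x) : ℝ :=
  -S.metric x (S.J x (S.ι x a)) (S.ι x b)

namespace IsNullPair

variable {S} {a b : TangentSpace (𝓡 2) x} (hab : S.IsNullPair a b)
include hab

theorem pairing' : S.g x b a = -1 := by rw [g_symm, hab.pairing]

theorem ext_g {t t' : TangentSpace (𝓡 2) x} (ha : S.g x t a = S.g x t' a)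
    (hb : S.g x t b = S.g x t' b) : t = t' :=
  S.ext_g_of_gram_ne_zero (by simp [hab.null_fst, hab.pairing]) ha hb

theorem eq_combination (w : TangentSpace (𝓡 2) x) : w = (-S.g x w b) • a + (-S.g x w a) • b :=
  hab.ext_g (by simp [hab.null_fst, hab.pairing']) (by simp [hab.null_snd, hab.pairing])

theorem tang_eq {w : E x} {t : TangentSpace (𝓡 2) x} (ha : S.g x t a = S.metric x w (S.ι x a))
    (hb : S.g x t b = S.metric x w (S.ι x b)) : S.tang x w = t :=
  hab.ext_g (by rw [g_tang, ha]) (by rw [g_tang, hb])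

/-- The Gram matrix of `a, b, Ja, Jb`. -/
theorem gram :
    S.metric x (S.ι x a) (S.ι x a) = 0 ∧ S.metric x (S.ι x a) (S.ι x b) = -1 ∧
    S.metric x (S.ι x b) (S.ι x a) = -1 ∧ S.metric x (S.ι x b) (S.ι x b) = 0 ∧
    S.metric x (S.ι x a) (S.J x (S.ι x a)) = 0 ∧
    S.metric x (S.ι x a) (S.J x (S.ι x b)) = S.sinhAngle a b ∧
    S.metric x (S.ι x b) (S.J x (S.ι x a)) = -S.sinhAngle a b ∧
    S.metric x (S.ι x b) (S.J x (S.ι x b)) = 0 ∧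
    S.metric x (S.J x (S.ι x a)) (S.ι x a) = 0 ∧
    S.metric x (S.J x (S.ι x a)) (S.ι x b) = -S.sinhAngle a b ∧
    S.metric x (S.J x (S.ι x b)) (S.ι x a) = S.sinhAngle a b ∧
    S.metric x (S.J x (S.ι x b)) (S.ι x b) = 0 ∧
    S.metric x (S.J x (S.ι x a)) (S.J x (S.ι x a)) = 0 ∧
    S.metric x (S.J x (S.ι x a)) (S.J x (S.ι x b)) = -1 ∧
    S.metric x (S.J x (S.ι x b)) (S.J x (S.ι x a)) = -1 ∧
    S.metric x (S.J x (S.ι x b)) (S.J x (S.ι x b)) = 0 := by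
  have h1 := hab.null_fst
  have h2 := hab.null_snd
  have h3 := hab.pairing
  have h4 := hab.pairing'
  rw [g_apply] at h1 h2 h3 h4
  have h5 : S.metric x (S.J x (S.ι x b)) (S.ι x a) = S.sinhAngle a b := by
    rw [metric_J_left, S.metric_symm]; rfl
  refine ⟨h1, h3, h4, h2, S.metric_self_J _, ?_, ?_, S.metric_self_J _, S.metric_J_self _, ?_,
    h5, S.metric_J_self _, ?_, ?_, ?_, ?_⟩
  · rw [S.metric_symm, h5]
  · rw [S.metric_symm]; simp [sinhAngle]
  · simp [sinhAngle]
  all_goals rw [S.J_isometry]; assumption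

/-- The planes spanned by `a, Ja` and by `b, Jb` are totally isotropic and are paired by a matrix of
determinant `1 + s²`, where `s` is the sine `sinhAngle`. This is positive for every `s`, so the Gram
matrix is invertible. -/
theorem eq_zero_of_metric_combination {p q r t : ℝ} {w : E x}
    (hw : w = p • S.ι x a + q • S.ι x b + r • S.J x (S.ι x a) + t • S.J x (S.ι x b))
    (ha : S.metric x w (S.ι x a) = 0) (hb : S.metric x w (S.ι x b) = 0)
    (hJa : S.metric x w (S.J x (S.ι x a)) = 0) (hJb : S.metric x w (S.J x (S.ι x b)) = 0) :
    p = 0 ∧ q = 0 ∧ r = 0 ∧ t = 0 := by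
  obtain ⟨g1, g2, g3, g4, g5, g6, g7, g8, g9, g10, g11, g12, g13, g14, g15, g16⟩ := hab.gram
  subst hw
  simp [g1, g3, g9, g11] at ha
  simp [g2, g4, g10, g12] at hb
  simp [g5, g7, g13, g15] at hJa
  simp [g6, g8, g14, g16] at hJb
  set s := S.sinhAngle a b
  have hs : (1 + s ^ 2) ≠ 0 := by positivity
  have hp : p = 0 := by
    have : p * (1 + s ^ 2) = 0 := by linear_combination -hb + s * hJb
    simpa [hs] using this
  have hq : q = 0 := by
    have : q * (1 + s ^ 2) = 0 := by linear_combination -ha - s * hJa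
    simpa [hs] using this
  subst hp hq
  refine ⟨rfl, rfl, ?_, ?_⟩ <;> linarith

theorem exists_eq_combination (w : E x) : ∃ p q r t : ℝ,
    w = p • S.ι x a + q • S.ι x b + r • S.J x (S.ι x a) + t • S.J x (S.ι x b) := by
  have hcard : Fintype.card (Fin 4) = Module.finrank ℝ (E x) := by
    rw [(VectorBundle.continuousLinearEquivAt ℝ R4 E x).toLinearEquiv.finrank_eq]
    simp
  have hli : LinearIndependent ℝ
      ![S.ι x a, S.ι x b, S.J x (S.ι x a), S.J x (S.ι x b)] := by
    rw [Fintype.linearIndependent_iff]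
    intro c hc
    simp only [Fin.sum_univ_four, Matrix.cons_val] at hc
    obtain ⟨h0, h1, h2, h3⟩ := hab.eq_zero_of_metric_combination hc.symm
      (by simp) (by simp) (by simp) (by simp)
    intro i
    fin_cases i <;> assumption
  have hw : w ∈ Submodule.span ℝ
      (Set.range ![S.ι x a, S.ι x b, S.J x (S.ι x a), S.J x (S.ι x b)]) := by
    have : FiniteDimensional ℝ (E x) := VectorBundle.finiteDimensional ℝ R4 E x
    rw [hli.span_eq_top_of_card_eq_finrank' hcard]; trivial
  obtain ⟨c, hc⟩ := (Submodule.mem_span_range_iff_exists_fun ℝ).1 hw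
  simp only [Fin.sum_univ_four, Matrix.cons_val] at hc
  exact ⟨_, _, _, _, hc.symm⟩

theorem ext_metric {w w' : E x} (ha : S.metric x w (S.ι x a) = S.metric x w' (S.ι x a))
    (hb : S.metric x w (S.ι x b) = S.metric x w' (S.ι x b))
    (hJa : S.metric x w (S.J x (S.ι x a)) = S.metric x w' (S.J x (S.ι x a)))
    (hJb : S.metric x w (S.J x (S.ι x b)) = S.metric x w' (S.J x (S.ι x b))) : w = w' := by
  obtain ⟨p, q, r, t, h⟩ := hab.exists_eq_combination (w - w')
  obtain ⟨rfl, rfl, rfl, rfl⟩ := hab.eq_zero_of_metric_combination h (by simp [ha])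
    (by simp [hb]) (by simp [hJa]) (by simp [hJb])
  exact sub_eq_zero.1 (by simpa using h)

/-- `J` is skew, so `Ja` is orthogonal to `a`; in a Lorentzian plane the vectors orthogonal to a
null vector are its multiples. -/
theorem P_fst : S.P x a = S.sinhAngle a b • a := by
  obtain ⟨g1, g2, g3, g4, g5, g6, g7, g8, g9, g10, g11, g12, g13, g14, g15, g16⟩ := hab.gram
  exact hab.tang_eq (by simp [hab.null_fst, g9]) (by simp [hab.pairing, g10])

theorem P_snd : S.P x b = -(S.sinhAngle a b • b) := by
  obtain ⟨g1, g2, g3, g4, g5, g6, g7, g8, g9, g10, g11, g12, g13, g14, g15, g16⟩ := hab.gram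
  exact hab.tang_eq (by simp [hab.pairing', g11]) (by simp [hab.null_snd, g12])

theorem F_fst : S.F x a = S.J x (S.ι x a) - S.sinhAngle a b • S.ι x a := by
  have h := hab.P_fst
  rw [P] at h
  simp [F, nor, h]

theorem F_snd : S.F x b = S.J x (S.ι x b) + S.sinhAngle a b • S.ι x b := by
  have h := hab.P_snd
  rw [P] at h
  simp [F, nor, h]

/-- A normal vector is a combination of `Fa` and `Fb`. -/
theorem eq_combination_F {w : E x} (hw : ∀ u, S.metric x w (S.ι x u) = 0) :
    w = (-(S.metric x w (S.J x (S.ι x b)) / (1 + S.sinhAngle a b ^ 2))) • S.F x a +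
      (-(S.metric x w (S.J x (S.ι x a)) / (1 + S.sinhAngle a b ^ 2))) • S.F x b := by
  obtain ⟨g1, g2, g3, g4, g5, g6, g7, g8, g9, g10, g11, g12, g13, g14, g15, g16⟩ := hab.gram
  have hs : (1 + S.sinhAngle a b ^ 2) ≠ 0 := by positivity
  -- `Fa, Fb` are null with product `-(1 + s²)`, and for normal `w` the products with `Fa, Fb` equal
  -- those with `Ja, Jb`; this dictates the coefficients.
  refine hab.ext_metric ?_ ?_ ?_ ?_ <;>
    simp only [hab.F_fst, hab.F_snd, hw, map_add, map_sub, map_smul, add_apply,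
      sub_apply, smul_apply, smul_eq_mul,
      g1, g2, g3, g4, g5, g6, g7, g8, g9, g10, g11, g12, g13, g14, g15, g16]
  · ring
  · ring
  · field_simp; ring
  · field_simp; ring

/-- Every normal vector is the normal part `Ju - Pu` of the image under `J` of a tangent vector. -/
theorem exists_eq_F {w : E x} (hw : ∀ u, S.metric x w (S.ι x u) = 0) :
    ∃ u v, w = S.J x (S.ι x u) - S.ι x v := by
  have h := hab.eq_combination_F hw
  rw [hab.F_fst, hab.F_snd] at h
  set p := -(S.metric x w (S.J x (S.ι x b)) / (1 + S.sinhAngle a b ^ 2))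
  set q := -(S.metric x w (S.J x (S.ι x a)) / (1 + S.sinhAngle a b ^ 2))
  refine ⟨p • a + q • b, (p * S.sinhAngle a b) • a - (q * S.sinhAngle a b) • b, ?_⟩
  rw [h]
  simp only [map_add, map_sub, map_smul]
  module

end IsNullPair

/-- The Kähler symmetry of the model curvature: replacing `Z` by `JZ` exchanges the first pair of
terms with the second, up to `J`. It transports the curvature equation from `u` to `Ju`. -/
theorem Rtilde_J (c : ℝ) (X Y Z : E x) :
    S.Rtilde c x X Y (S.J x Z) = S.J x (S.Rtilde c x X Y Z) := by
  have h1 : S.metric x Y (S.J x Z) = -S.metric x (S.J x Y) Z := by rw [metric_J_left]; simp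
  have h2 : S.metric x X (S.J x Z) = -S.metric x (S.J x X) Z := by rw [metric_J_left]; simp
  simp only [Rtilde, S.J_isometry, S.J_sq, map_smul, map_add, map_sub, h1, h2]
  module

theorem Rtilde_sub (c : ℝ) (X Y Z W : E x) :
    S.Rtilde c x X Y (Z - W) = S.Rtilde c x X Y Z - S.Rtilde c x X Y W := by
  simp only [Rtilde, map_sub]
  module

end Pointwise

end LorentzianSurface

namespace LorentzianSurface

variable {M : Type*} [TopologicalSpace M] [ChartedSpace (EuclideanSpace ℝ (Fin 2)) M]
  [IsManifold (𝓡 2) ∞ M]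
  {E : M → Type*} [TopologicalSpace (TotalSpace R4 E)] [∀ x, AddCommGroup (E x)]
  [∀ x, Module ℝ (E x)] [∀ x, TopologicalSpace (E x)] [∀ x, IsTopologicalAddGroup (E x)]
  [∀ x, ContinuousSMul ℝ (E x)] [FiberBundle R4 E] [VectorBundle ℝ R4 E]
  [ContMDiffVectorBundle ∞ R4 E (𝓡 2)]
  (S : LorentzianSurface M E)

/-! ### Regularity of the metric, the connection and the two projections. -/

section Regularity

variable {x : M} {X Y Z W : ∀ x : M, TangentSpace (𝓡 2) x} {σ τ : ∀ x, E x}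

theorem smoothSec_ι (hY : SmoothField Y) : SmoothSec fun y ↦ S.ι y (Y y) :=
  ContMDiff.clm_bundle_apply S.ι_contMDiff hY

theorem diffSecAt_ι (hY : DiffFieldAt Y x) : DiffSecAt (fun y ↦ S.ι y (Y y)) x :=
  MDifferentiableAt.clm_bundle_apply (S.ι_contMDiff.mdifferentiable (by simp) x) hY

theorem smoothSec_J (hσ : SmoothSec σ) : SmoothSec fun y ↦ S.J y (σ y) :=
  ContMDiff.clm_bundle_apply S.J_contMDiff hσ

theorem diffSecAt_J (hσ : DiffSecAt σ x) : DiffSecAt (fun y ↦ S.J y (σ y)) x :=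
  MDifferentiableAt.clm_bundle_apply (S.J_contMDiff.mdifferentiable (by simp) x) hσ

theorem contMDiffOn_metric {U : Set M}
    (hσ : ContMDiffOn (𝓡 2) ((𝓡 2).prod 𝓘(ℝ, R4)) ∞ (fun x ↦ TotalSpace.mk' R4 x (σ x)) U)
    (hτ : ContMDiffOn (𝓡 2) ((𝓡 2).prod 𝓘(ℝ, R4)) ∞ (fun x ↦ TotalSpace.mk' R4 x (τ x)) U) :
    ContMDiffOn (𝓡 2) 𝓘(ℝ, ℝ) ∞ (fun y ↦ S.metric y (σ y) (τ y)) U := by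
  intro x hx
  have : ContMDiffWithinAt (𝓡 2) ((𝓡 2).prod 𝓘(ℝ)) ∞
      (fun m ↦ TotalSpace.mk' ℝ (E := Bundle.Trivial M ℝ) m (S.metric m (σ m) (τ m))) U x := by
    apply ContMDiffWithinAt.clm_bundle_apply₂ (F₁ := R4) (F₂ := R4)
    · exact S.metric_contMDiff.contMDiffAt.contMDiffWithinAt
    · exact hσ x hx
    · exact hτ x hx
  simp only [contMDiffWithinAt_totalSpace] at this
  exact this.2

theorem contMDiff_metric (hσ : SmoothSec σ) (hτ : SmoothSec τ) :
    ContMDiff (𝓡 2) 𝓘(ℝ, ℝ) ∞ fun y ↦ S.metric y (σ y) (τ y) :=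
  contMDiffOn_univ.1 (S.contMDiffOn_metric (contMDiffOn_univ.2 hσ) (contMDiffOn_univ.2 hτ))

theorem mdifferentiableAt_metric (hσ : DiffSecAt σ x) (hτ : DiffSecAt τ x) :
    MDifferentiableAt (𝓡 2) 𝓘(ℝ, ℝ) (fun y ↦ S.metric y (σ y) (τ y)) x := by
  have : MDifferentiableAt (𝓡 2) ((𝓡 2).prod 𝓘(ℝ))
      (fun m ↦ TotalSpace.mk' ℝ (E := Bundle.Trivial M ℝ) m (S.metric m (σ m) (τ m))) x := by
    apply MDifferentiableAt.clm_bundle_apply₂ (F₁ := R4) (F₂ := R4)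
    · exact S.metric_contMDiff.mdifferentiable (by simp) x
    · exact hσ
    · exact hτ
  simp only [mdifferentiableAt_totalSpace] at this
  exact this.2

theorem smoothSec_conn (hσ : SmoothSec σ) (hX : SmoothField X) :
    SmoothSec fun y ↦ S.conn σ y (X y) := by
  have h := S.conn_contMDiff.contMDiff.contMDiff (σ := σ) (contMDiffOn_univ.2 (by simpa using! hσ))
  exact ContMDiff.clm_bundle_apply (contMDiffOn_univ.1 h) hX

/-- The tangential component of a differentiable section is differentiable. -/
theorem diffFieldAt_tang [T2Space M] (hσ : DiffSecAt σ x) :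
    DiffFieldAt (fun y ↦ S.tang y (σ y)) x := by
  obtain ⟨a, b, hab⟩ := S.exists_isNullPair x
  obtain ⟨A, hA, rfl⟩ := exists_smoothField_apply_eq a
  obtain ⟨B, hB, rfl⟩ := exists_smoothField_apply_eq b
  have sA := S.smoothSec_ι hA
  have sB := S.smoothSec_ι hB
  -- The Gram determinant of `A, B`. It is `-1` at `x`, hence nonzero nearby, and Cramer's rule
  -- writes the tangential part as a combination of `A, B` with differentiable coefficients.
  set D : M → ℝ := fun y ↦ S.g y (A y) (A y) * S.g y (B y) (B y) - S.g y (A y) (B y) ^ 2 with hD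
  have cAA : ContMDiff (𝓡 2) 𝓘(ℝ, ℝ) ∞ fun y ↦ S.g y (A y) (A y) := S.contMDiff_metric sA sA
  have cAB : ContMDiff (𝓡 2) 𝓘(ℝ, ℝ) ∞ fun y ↦ S.g y (A y) (B y) := S.contMDiff_metric sA sB
  have cBB : ContMDiff (𝓡 2) 𝓘(ℝ, ℝ) ∞ fun y ↦ S.g y (B y) (B y) := S.contMDiff_metric sB sB
  have cD : ContMDiff (𝓡 2) 𝓘(ℝ, ℝ) ∞ D := (cAA.mul cBB).sub (cAB.pow 2)
  have hDx : D x ≠ 0 := by simp [hD, hab.null_fst, hab.pairing]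
  have dA := S.mdifferentiableAt_metric hσ (sA.diffSecAt x)
  have dB := S.mdifferentiableAt_metric hσ (sB.diffSecAt x)
  have dAA := cAA.mdifferentiable (by simp) x
  have dAB := cAB.mdifferentiable (by simp) x
  have dBB := cBB.mdifferentiable (by simp) x
  have dD : MDifferentiableAt (𝓡 2) 𝓘(ℝ, ℝ) (fun y ↦ (D y)⁻¹) x :=
    (cD.contMDiffAt.inv₀ hDx).mdifferentiableAt (by simp)
  have key : ∀ᶠ y in 𝓝 x, S.tang y (σ y) =
      ((D y)⁻¹ * (S.g y (B y) (B y) * S.metric y (σ y) (S.ι y (A y))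
        - S.g y (A y) (B y) * S.metric y (σ y) (S.ι y (B y)))) • A y +
      ((D y)⁻¹ * (S.g y (A y) (A y) * S.metric y (σ y) (S.ι y (B y))
        - S.g y (A y) (B y) * S.metric y (σ y) (S.ι y (A y)))) • B y := by
    filter_upwards [cD.continuous.continuousAt.eventually_ne hDx] with y hy
    have hBA := S.g_symm (B y) (A y)
    refine S.ext_g_of_gram_ne_zero (a := A y) (b := B y) hy ?_ ?_ <;>
      rw [g_tang] <;>
      simp only [map_add, map_smul, LinearMap.add_apply, LinearMap.smul_apply, smul_eq_mul, hBA]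
    · field_simp
      simp only [hD]; ring
    · field_simp
      simp only [hD]; ring
  refine MDifferentiableAt.congr_of_eventuallyEq (f := fun y ↦
      TotalSpace.mk' (EuclideanSpace ℝ (Fin 2)) y
      (((D y)⁻¹ * (S.g y (B y) (B y) * S.metric y (σ y) (S.ι y (A y))
        - S.g y (A y) (B y) * S.metric y (σ y) (S.ι y (B y)))) • A y +
      ((D y)⁻¹ * (S.g y (A y) (A y) * S.metric y (σ y) (S.ι y (B y))
        - S.g y (A y) (B y) * S.metric y (σ y) (S.ι y (A y)))) • B y)) ?_ ?_
  · exact mdifferentiableAt_add_section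
      (MDifferentiableAt.smul_section (dD.mul ((dBB.mul dA).sub (dAB.mul dB))) (hA.diffFieldAt x))
      (MDifferentiableAt.smul_section (dD.mul ((dAA.mul dB).sub (dAB.mul dA))) (hB.diffFieldAt x))
  · filter_upwards [key] with y hy
    rw [hy]

theorem diffSecAt_nor [T2Space M] (hσ : DiffSecAt σ x) : DiffSecAt (fun y ↦ S.nor y (σ y)) x :=
  hσ.sub (S.diffSecAt_ι (S.diffFieldAt_tang hσ))

end Regularity

/-! ### The formulas of Gauss and Weingarten. -/

section Connection

variable {x : M} {X Y Z W : ∀ x : M, TangentSpace (𝓡 2) x} {σ τ : ∀ x, E x}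

theorem conn_add (hσ : DiffSecAt σ x) (hτ : DiffSecAt τ x) (u : TangentSpace (𝓡 2) x) :
    S.conn (fun y ↦ σ y + τ y) x u = S.conn σ x u + S.conn τ x u :=
  congrArg (fun L : TangentSpace (𝓡 2) x →L[ℝ] E x ↦ L u)
    (S.conn.isCovariantDerivativeOnUniv.add hσ hτ)

theorem conn_sub (hσ : DiffSecAt σ x) (hτ : DiffSecAt τ x) (u : TangentSpace (𝓡 2) x) :
    S.conn (fun y ↦ σ y - τ y) x u = S.conn σ x u - S.conn τ x u := by
  have h := S.conn_add (hσ.sub hτ) hτ u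
  simp only [sub_add_cancel] at h
  rw [h, add_sub_cancel_right]

theorem conn_congr (hσ : DiffSecAt σ x) (h : ∀ᶠ y in 𝓝 x, σ y = τ y) :
    S.conn σ x = S.conn τ x :=
  S.conn.isCovariantDerivativeOnUniv.congr_of_eventuallyEq hσ
    (MDifferentiableAt.congr_of_eventuallyEq (f := fun y ↦ TotalSpace.mk' R4 y (σ y)) hσ
      (by filter_upwards [h] with y hy; rw [hy])) Filter.univ_mem h

theorem dirDeriv_metric (hσ : DiffSecAt σ x) (hτ : DiffSecAt τ x) :
    dirDeriv X (fun y ↦ S.metric y (σ y) (τ y)) x =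
      S.metric x (S.conn σ x (X x)) (τ x) + S.metric x (σ x) (S.conn τ x (X x)) :=
  S.conn_metric x σ τ hσ hτ (X x)

/-- The formula of Gauss. -/
theorem ι_nabla_add_h : S.ι x (S.nabla Y x (X x)) + S.h X Y x =
    S.conn (fun y ↦ S.ι y (Y y)) x (X x) :=
  S.ι_tang_add_nor _

theorem metric_h_ι (u : TangentSpace (𝓡 2) x) : S.metric x (S.h X Y x) (S.ι x u) = 0 :=
  S.metric_nor_ι x _ u

theorem nabla_sub_nabla (hX : DiffFieldAt X x) (hY : DiffFieldAt Y x) :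
    S.nabla Y x (X x) - S.nabla X x (Y x) = VectorField.mlieBracket (𝓡 2) X Y x := by
  rw [nabla, nabla, ← tang_sub, S.torsion_free x X Y hX hY, tang_ι]

/-- The torsion identity has a tangent right-hand side, so its normal part vanishes. -/
theorem h_symm (hX : DiffFieldAt X x) (hY : DiffFieldAt Y x) : S.h X Y x = S.h Y X x := by
  rw [← sub_eq_zero, h, h, ← nor_sub, S.torsion_free x X Y hX hY, nor_ι]

/-- Tensoriality of `h`. The first argument enters only through its value at `x`; symmetry passes
this on to the second, which is differentiated in the definition. -/
theorem h_combination {A B : ∀ x : M, TangentSpace (𝓡 2) x}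
    (hA : DiffFieldAt A x) (hB : DiffFieldAt B x) (hY : DiffFieldAt Y x)
    {p q r t : ℝ} (hXx : X x = p • A x + q • B x) (hYx : Y x = r • A x + t • B x) :
    S.h X Y x = (p * r) • S.h A A x + (p * t + q * r) • S.h A B x + (q * t) • S.h B B x := by
  have left : ∀ {V Z : ∀ x : M, TangentSpace (𝓡 2) x} {p q : ℝ}, V x = p • A x + q • B x →
      S.h V Z x = p • S.h A Z x + q • S.h B Z x := fun hV ↦ by
    simp only [h, hV, map_add, map_smul, nor_add, nor_smul]
  rw [left hXx, S.h_symm hA hY, S.h_symm hB hY, left hYx, left hYx, S.h_symm hB hA]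
  module

/-- Differentiating `⟨n, ιW⟩ = 0` for a normal section `n`. -/
theorem metric_conn_normal {n : ∀ x, E x} (hn : S.IsNormal n) (hnd : DiffSecAt n x)
    (hW : DiffFieldAt W x) (u : TangentSpace (𝓡 2) x) :
    S.metric x (S.conn n x u) (S.ι x (W x)) =
      -S.metric x (n x) (S.conn (fun y ↦ S.ι y (W y)) x u) := by
  have h := S.conn_metric x n _ hnd (S.diffSecAt_ι hW) u
  have h0 : (fun y ↦ S.metric y (n y) (S.ι y (W y))) = fun _ ↦ 0 := funext fun y ↦ hn y _
  rw [h0, mvfderiv_const] at h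
  simp only [zero_apply] at h
  linarith

/-- The shape operator is the adjoint of `h`. -/
theorem metric_conn_normal_eq_h {n : ∀ x, E x} (hn : S.IsNormal n) (hnd : DiffSecAt n x)
    (hW : DiffFieldAt W x) :
    S.metric x (S.conn n x (X x)) (S.ι x (W x)) = -S.metric x (S.h X W x) (n x) := by
  rw [S.metric_conn_normal hn hnd hW, h, S.metric_nor_left_of_normal (hn x), S.metric_symm]

end Connection

/-! ### Curvature of the ambient connection, and the equation of Ricci. -/

section Curvature

/-- The curvature `∇̃_X ∇̃_Y σ - ∇̃_Y ∇̃_X σ - ∇̃_[X,Y] σ` of the ambient connection. -/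
noncomputable def ambientCurvature (X Y : ∀ x : M, TangentSpace (𝓡 2) x) (σ : ∀ x, E x) (x : M) :
    E x :=
  S.conn (fun y ↦ S.conn σ y (Y y)) x (X x) - S.conn (fun y ↦ S.conn σ y (X y)) x (Y x)
    - S.conn σ x (VectorField.mlieBracket (𝓡 2) X Y x)

variable {x : M} {X Y Z W : ∀ x : M, TangentSpace (𝓡 2) x} {σ τ : ∀ x, E x}

theorem ambientCurvature_sub (hX : SmoothField X) (hY : SmoothField Y) (hσ : SmoothSec σ)
    (hτ : SmoothSec τ) : S.ambientCurvature X Y (fun y ↦ σ y - τ y) x =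
      S.ambientCurvature X Y σ x - S.ambientCurvature X Y τ x := by
  have hc : ∀ y u, S.conn (fun y ↦ σ y - τ y) y u = S.conn σ y u - S.conn τ y u := fun y u ↦
    S.conn_sub (hσ.diffSecAt y) (hτ.diffSecAt y) u
  simp only [ambientCurvature, hc]
  rw [S.conn_sub ((S.smoothSec_conn hσ hY).diffSecAt x) ((S.smoothSec_conn hτ hY).diffSecAt x),
    S.conn_sub ((S.smoothSec_conn hσ hX).diffSecAt x) ((S.smoothSec_conn hτ hX).diffSecAt x)]
  abel

theorem ambientCurvature_J (hX : SmoothField X) (hY : SmoothField Y) (hσ : SmoothSec σ) :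
    S.ambientCurvature X Y (fun y ↦ S.J y (σ y)) x = S.J x (S.ambientCurvature X Y σ x) := by
  have hc : ∀ y u, S.conn (fun y ↦ S.J y (σ y)) y u = S.J y (S.conn σ y u) := fun y u ↦
    S.conn_J y σ (hσ.diffSecAt y) u
  simp only [ambientCurvature, hc, map_sub]
  rw [S.conn_J x _ ((S.smoothSec_conn hσ hY).diffSecAt x),
    S.conn_J x _ ((S.smoothSec_conn hσ hX).diffSecAt x)]

/-- The curvature of a metric connection is skew. -/
theorem metric_ambientCurvature [T2Space M] (hX : SmoothField X) (hY : SmoothField Y)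
    (hσ : SmoothSec σ) (hτ : SmoothSec τ) :
    S.metric x (S.ambientCurvature X Y σ x) (τ x) =
      -S.metric x (σ x) (S.ambientCurvature X Y τ x) := by
  have hf : ∀ Z : ∀ x : M, TangentSpace (𝓡 2) x, dirDeriv Z (fun y ↦ S.metric y (σ y) (τ y)) =
      fun y ↦ S.metric y (S.conn σ y (Z y)) (τ y) + S.metric y (σ y) (S.conn τ y (Z y)) :=
    fun Z ↦ funext fun y ↦ S.dirDeriv_metric (hσ.diffSecAt y) (hτ.diffSecAt y)
  have dσ := hσ.diffSecAt x
  have dτ := hτ.diffSecAt x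
  have dc : ∀ {Z : ∀ x : M, TangentSpace (𝓡 2) x} {ρ : ∀ x, E x}, SmoothField Z → SmoothSec ρ →
      DiffSecAt (fun y ↦ S.conn ρ y (Z y)) x := fun hZ hρ ↦ (S.smoothSec_conn hρ hZ).diffSecAt x
  have d₁ : ∀ {Z : ∀ x : M, TangentSpace (𝓡 2) x}, SmoothField Z →
      MDifferentiableAt (𝓡 2) 𝓘(ℝ, ℝ) (fun y ↦ S.metric y (S.conn σ y (Z y)) (τ y)) x :=
    fun hZ ↦ S.mdifferentiableAt_metric (dc hZ hσ) dτ
  have d₂ : ∀ {Z : ∀ x : M, TangentSpace (𝓡 2) x}, SmoothField Z →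
      MDifferentiableAt (𝓡 2) 𝓘(ℝ, ℝ) (fun y ↦ S.metric y (σ y) (S.conn τ y (Z y))) x :=
    fun hZ ↦ S.mdifferentiableAt_metric dσ (dc hZ hτ)
  -- The two mixed terms are symmetric in `V, Z`, so they cancel in the commutator and only
  -- curvature terms remain.
  have hff : ∀ {V Z : ∀ x : M, TangentSpace (𝓡 2) x}, SmoothField Z →
      dirDeriv V (dirDeriv Z (fun y ↦ S.metric y (σ y) (τ y))) x =
        (S.metric x (S.conn (fun y ↦ S.conn σ y (Z y)) x (V x)) (τ x) +
          S.metric x (S.conn σ x (Z x)) (S.conn τ x (V x))) +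
        (S.metric x (S.conn σ x (V x)) (S.conn τ x (Z x)) +
          S.metric x (σ x) (S.conn (fun y ↦ S.conn τ y (Z y)) x (V x))) := fun {V Z} hZ ↦ by
    rw [hf Z, dirDeriv, mvfderiv_fun_add (d₁ hZ) (d₂ hZ), add_apply]
    exact congrArg₂ (· + ·) (S.dirDeriv_metric (dc hZ hσ) dτ) (S.dirDeriv_metric dσ (dc hZ hτ))
  have hb := dirDeriv_mlieBracket hX hY (S.contMDiff_metric hσ hτ) (x := x)
    (by rw [hf]; exact (d₁ hX).add (d₂ hX)) (by rw [hf]; exact (d₁ hY).add (d₂ hY))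
  rw [hff hX, hff hY, S.dirDeriv_metric dσ dτ] at hb
  simp only [ambientCurvature, map_sub, sub_apply]
  linarith

/-- The ambient curvature depends only on the value of the section at the point. -/
theorem ambientCurvature_congr [T2Space M] (hX : SmoothField X) (hY : SmoothField Y)
    (hσ : SmoothSec σ) (hτ : SmoothSec τ) (h : σ x = τ x) :
    S.ambientCurvature X Y σ x = S.ambientCurvature X Y τ x := by
  obtain ⟨a, b, hab⟩ := S.exists_isNullPair x
  obtain ⟨A, hA, rfl⟩ := exists_smoothField_apply_eq a
  obtain ⟨B, hB, rfl⟩ := exists_smoothField_apply_eq b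
  -- Skewness moves the derivatives onto `ρ`, after which only the value of `σ` at `x` is left.
  have key : ∀ {ρ : ∀ x, E x}, SmoothSec ρ → S.metric x (S.ambientCurvature X Y σ x) (ρ x) =
      S.metric x (S.ambientCurvature X Y τ x) (ρ x) := fun hρ ↦ by
    rw [S.metric_ambientCurvature hX hY hσ hρ, S.metric_ambientCurvature hX hY hτ hρ, h]
  exact hab.ext_metric (key (S.smoothSec_ι hA)) (key (S.smoothSec_ι hB))
    (key (S.smoothSec_J (S.smoothSec_ι hA))) (key (S.smoothSec_J (S.smoothSec_ι hB)))

theorem diffFieldAt_nabla [T2Space M] (hY : SmoothField Y) (hZ : SmoothField Z) :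
    DiffFieldAt (fun y ↦ S.nabla Z y (Y y)) x :=
  S.diffFieldAt_tang ((S.smoothSec_conn (S.smoothSec_ι hZ) hY).diffSecAt x)

theorem diffSecAt_h [T2Space M] (hY : SmoothField Y) (hZ : SmoothField Z) :
    DiffSecAt (S.h Y Z) x :=
  S.diffSecAt_nor ((S.smoothSec_conn (S.smoothSec_ι hZ) hY).diffSecAt x)

theorem conn_conn_ι [T2Space M] (hY : SmoothField Y) (hZ : SmoothField Z)
    (u : TangentSpace (𝓡 2) x) :
    S.conn (fun y ↦ S.conn (fun y ↦ S.ι y (Z y)) y (Y y)) x u =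
      S.conn (fun y ↦ S.ι y (S.nabla Z y (Y y))) x u + S.conn (S.h Y Z) x u := by
  rw [← S.conn_add (S.diffSecAt_ι (S.diffFieldAt_nabla hY hZ)) (S.diffSecAt_h hY hZ)]
  simp only [ι_nabla_add_h]

/-- The equation of Gauss for the curvature of the ambient connection. -/
theorem g_R [T2Space M] (hX : SmoothField X) (hY : SmoothField Y) (hZ : SmoothField Z)
    (hW : SmoothField W) :
    S.g x (S.R X Y Z x) (W x) =
      S.metric x (S.ambientCurvature X Y (fun y ↦ S.ι y (Z y)) x) (S.ι x (W x))
        + S.metric x (S.h X W x) (S.h Y Z x) - S.metric x (S.h X Z x) (S.h Y W x) := by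
  have h1 := S.metric_conn_normal_eq_h (X := X) (fun y u ↦ S.metric_h_ι (X := Y) (Y := Z) u)
    (S.diffSecAt_h hY hZ) (hW.diffFieldAt x)
  have h2 := S.metric_conn_normal_eq_h (X := Y) (fun y u ↦ S.metric_h_ι (X := X) (Y := Z) u)
    (S.diffSecAt_h hX hZ) (hW.diffFieldAt x)
  rw [S.metric_symm x (S.h Y W x)] at h2
  rw [ambientCurvature, S.conn_conn_ι hY hZ, S.conn_conn_ι hX hZ, R]
  simp only [map_sub, map_add, LinearMap.sub_apply, sub_apply, add_apply, h1, h2]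
  rw [nabla, nabla, nabla, g_tang, g_tang, g_tang]
  ring

/-- The equation of Codazzi for the curvature of the ambient connection. -/
theorem nor_ambientCurvature [T2Space M] (hX : SmoothField X) (hY : SmoothField Y)
    (hZ : SmoothField Z) :
    S.nor x (S.ambientCurvature X Y (fun y ↦ S.ι y (Z y)) x) =
      S.nablaBarH X Y Z x - S.nablaBarH Y X Z x := by
  rw [ambientCurvature, S.conn_conn_ι hY hZ, S.conn_conn_ι hX hZ,
    ← S.nabla_sub_nabla (hX.diffFieldAt x) (hY.diffFieldAt x)]
  simp only [map_sub, nor_sub, nor_add, nablaBarH, normalConn, h]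
  abel

/-- The equation of Ricci for the curvature of the ambient connection. -/
theorem metric_RD [T2Space M] {ξ η : ∀ x, E x} (hX : SmoothField X) (hY : SmoothField Y)
    (hξ : SmoothSec ξ) (hη : SmoothSec η) (hξn : S.IsNormal ξ) (hηn : S.IsNormal η) :
    S.metric x (S.RD X Y ξ x) (η x) = S.metric x (S.ambientCurvature X Y ξ x) (η x)
      + S.g x (S.shape ξ (S.shape η X) x - S.shape η (S.shape ξ X) x) (Y x) := by
  have dshape : ∀ {ζ : ∀ x, E x} {V : ∀ x : M, TangentSpace (𝓡 2) x}, SmoothSec ζ →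
      SmoothField V → DiffFieldAt (S.shape ζ V) x := fun hζ hV ↦
    mdifferentiableAt_neg_section
      (S.diffFieldAt_tang ((S.smoothSec_conn hζ hV).diffSecAt x))
  have hshape : ∀ {ζ : ∀ x, E x} {V W : ∀ x : M, TangentSpace (𝓡 2) x}, SmoothSec ζ →
      S.IsNormal ζ → DiffFieldAt W x →
      S.g x (S.shape ζ V x) (W x) = S.metric x (S.h V W x) (ζ x) := fun {ζ V W} hζ hn hW ↦ by
    have := S.metric_conn_normal_eq_h (X := V) hn (hζ.diffSecAt x) hW
    rw [shape, map_neg, LinearMap.neg_apply, g_tang, this, neg_neg]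
  have hsymm : ∀ {ζ : ∀ x, E x} {V W : ∀ x : M, TangentSpace (𝓡 2) x}, SmoothSec ζ →
      S.IsNormal ζ → DiffFieldAt V x → DiffFieldAt W x →
      S.g x (S.shape ζ V x) (W x) = S.g x (S.shape ζ W x) (V x) := fun hζ hn hV hW ↦ by
    rw [hshape hζ hn hW, hshape hζ hn hV, S.h_symm hV hW]
  -- By Weingarten `∇̃ξ = Dξ - A_ξ`; differentiating the tangent summand again contributes `h(V, A_ξ
  -- V')`, whose product with `η` is a product of shape operators.
  have hconn : ∀ {V V' : ∀ x : M, TangentSpace (𝓡 2) x}, SmoothField V → SmoothField V' →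
      S.metric x (S.conn (fun y ↦ S.conn ξ y (V' y)) x (V x)) (η x) =
        S.metric x (S.normalConn (fun y ↦ S.normalConn ξ y (V' y)) x (V x)) (η x)
          - S.g x (S.shape η V x) (S.shape ξ V' x) := fun {V V'} hV hV' ↦ by
    have hs : (fun y ↦ S.conn ξ y (V' y)) =
        fun y ↦ S.normalConn ξ y (V' y) - S.ι y (S.shape ξ V' y) := funext fun y ↦ by
      simp [normalConn, nor, shape]
    rw [hshape hη hηn (dshape hξ hV'), h, S.metric_nor_left_of_normal (hηn x), normalConn,
      S.metric_nor_left_of_normal (hηn x), hs, S.conn_sub (σ := fun y ↦ S.normalConn ξ y (V' y))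
        (S.diffSecAt_nor ((S.smoothSec_conn hξ hV').diffSecAt x))
        (S.diffSecAt_ι (dshape hξ hV'))]
    simp
  have e1 : S.metric x (S.conn ξ x (VectorField.mlieBracket (𝓡 2) X Y x)) (η x) =
      S.metric x (S.normalConn ξ x (VectorField.mlieBracket (𝓡 2) X Y x)) (η x) := by
    rw [normalConn, S.metric_nor_left_of_normal (hηn x)]
  rw [ambientCurvature, RD]
  simp only [map_sub, sub_apply, LinearMap.sub_apply, hconn hX hY, hconn hY hX, e1]
  rw [hsymm hξ hξn (dshape hη hX) (hY.diffFieldAt x), hsymm hη hηn (dshape hξ hX)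
    (hY.diffFieldAt x), S.g_symm (S.shape ξ Y x)]
  ring

/-- The equation of Ricci is a consequence of the equations of Gauss and Codazzi. -/
theorem RicciAt_of_GaussAt_of_CodazziAt [T2Space M] {c : ℝ} (hG : S.GaussAt c x)
    (hC : S.CodazziAt c x) : S.RicciAt c x := by
  intro X Y ξ η hX hY hξ hη hξn hηn
  -- Gauss identifies the tangential parts of the two curvatures and Codazzi the normal parts.
  have hT : ∀ {Z : ∀ x : M, TangentSpace (𝓡 2) x}, SmoothField Z →
      S.ambientCurvature X Y (fun y ↦ S.ι y (Z y)) x =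
        S.Rtilde c x (S.ι x (X x)) (S.ι x (Y x)) (S.ι x (Z x)) := fun {Z} hZ ↦ by
    rw [← S.ι_tang_add_nor (S.ambientCurvature X Y (fun y ↦ S.ι y (Z y)) x),
      S.nor_ambientCurvature hX hY hZ, ← hC X Y Z hX hY hZ]
    refine Eq.trans ?_ (S.ι_tang_add_nor _)
    congr 2
    refine S.eq_of_g_eq fun w ↦ ?_
    obtain ⟨W, hW, rfl⟩ := exists_smoothField_apply_eq w
    have h := hG X Y Z W hX hY hZ hW
    rw [S.g_R hX hY hZ hW] at h
    rw [g_tang, g_tang]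
    linarith
  obtain ⟨a, b, hab⟩ := S.exists_isNullPair x
  obtain ⟨u, v, huv⟩ := hab.exists_eq_F (hξn x)
  obtain ⟨A, hA, rfl⟩ := exists_smoothField_apply_eq u
  obtain ⟨B, hB, rfl⟩ := exists_smoothField_apply_eq v
  have sA := S.smoothSec_ι hA
  have sB := S.smoothSec_ι hB
  -- `ξ` equals `JA - B` only at the point `x`, which is enough for the curvature.
  have hξx : S.ambientCurvature X Y ξ x = S.Rtilde c x (S.ι x (X x)) (S.ι x (Y x)) (ξ x) := by
    rw [S.ambientCurvature_congr (τ := fun y ↦ S.J y (S.ι y (A y)) - S.ι y (B y)) hX hY hξ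
        (ContMDiff.sub_section (S.smoothSec_J sA) sB) huv,
      S.ambientCurvature_sub hX hY (S.smoothSec_J sA) sB, S.ambientCurvature_J hX hY sA,
      hT hA, hT hB, huv, Rtilde_sub, Rtilde_J]
  rw [S.metric_RD hX hY hξ hη hξn hηn, hξx]

end Curvature

end LorentzianSurface

/-! ### Calculus rules for directional derivatives. -/

section DirDeriv

variable {M : Type*} [TopologicalSpace M] [ChartedSpace (EuclideanSpace ℝ (Fin 2)) M]
  {X : ∀ x : M, TangentSpace (𝓡 2) x} {f f' : M → ℝ} {x : M}

theorem dirDeriv_congr (h : f =ᶠ[𝓝 x] f') : dirDeriv X f x = dirDeriv X f' x := by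
  have := h.mfderiv_eq (I := 𝓡 2) (I' := 𝓘(ℝ, ℝ))
  exact congrArg (fun L : TangentSpace (𝓡 2) x →L[ℝ] ℝ ↦ L (X x)) this

theorem dirDeriv_comp {F : ℝ → ℝ} {F' : ℝ} (hF : HasDerivAt F F' (f x))
    (hf : MDifferentiableAt (𝓡 2) 𝓘(ℝ, ℝ) f x) :
    dirDeriv X (fun y ↦ F (f y)) x = F' * dirDeriv X f x := by
  have h := (hF.hasFDerivAt.hasMFDerivAt.comp x hf.hasMFDerivAt).mfderiv
  have h' := congrArg (fun L : TangentSpace (𝓡 2) x →L[ℝ] ℝ ↦ L (X x)) h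
  refine h'.trans ?_
  change dirDeriv X f x * F' = _
  ring

theorem dirDeriv_mul (hf : MDifferentiableAt (𝓡 2) 𝓘(ℝ, ℝ) f x)
    (hf' : MDifferentiableAt (𝓡 2) 𝓘(ℝ, ℝ) f' x) :
    dirDeriv X (fun y ↦ f y * f' y) x = f x * dirDeriv X f' x + f' x * dirDeriv X f x := by
  rw [dirDeriv, mvfderiv_fun_mul hf hf']
  rfl

end DirDeriv

namespace LorentzianSurface

variable {M : Type*} [TopologicalSpace M] [ChartedSpace (EuclideanSpace ℝ (Fin 2)) M]
  [IsManifold (𝓡 2) ∞ M]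
  {E : M → Type*} [TopologicalSpace (TotalSpace R4 E)] [∀ x, AddCommGroup (E x)]
  [∀ x, Module ℝ (E x)] [∀ x, TopologicalSpace (E x)] [∀ x, IsTopologicalAddGroup (E x)]
  [∀ x, ContinuousSMul ℝ (E x)] [FiberBundle R4 E] [VectorBundle ℝ R4 E]
  [ContMDiffVectorBundle ∞ R4 E (𝓡 2)]
  {S : LorentzianSurface M E}

/-! ### The normal plane and the model curvature in a null basis. -/

namespace IsNullPair

variable {x : M} {a b : TangentSpace (𝓡 2) x} (hab : S.IsNullPair a b)
include hab

theorem metric_combination_F (p q r t : ℝ) :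
    S.metric x (p • S.F x a + q • S.F x b) (r • S.F x a + t • S.F x b) =
      -(1 + S.sinhAngle a b ^ 2) * (p * t + q * r) := by
  obtain ⟨g1, g2, g3, g4, g5, g6, g7, g8, g9, g10, g11, g12, g13, g14, g15, g16⟩ := hab.gram
  simp only [hab.F_fst, hab.F_snd, map_add, map_sub, map_smul, add_apply, sub_apply, smul_apply,
    smul_eq_mul, g1, g2, g3, g4, g5, g6, g7, g8, g9, g10, g11, g12, g13, g14, g15, g16]
  ring

/-- `Fa` and `Fb` are eigenvectors of the normal part of `J`, with eigenvalues `-s` and `s`, where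
`s` is `sinhAngle`. -/
theorem metric_combination_F_J (p q r t : ℝ) :
    S.metric x (p • S.F x a + q • S.F x b) (S.J x (r • S.F x a + t • S.F x b)) =
      (1 + S.sinhAngle a b ^ 2) * S.sinhAngle a b * (q * r - p * t) := by
  obtain ⟨g1, g2, g3, g4, g5, g6, g7, g8, g9, g10, g11, g12, g13, g14, g15, g16⟩ := hab.gram
  simp only [hab.F_fst, hab.F_snd, map_add, map_sub, map_smul, map_neg, S.J_sq, add_apply,
    sub_apply, smul_apply, smul_eq_mul,
    g1, g2, g3, g4, g5, g6, g7, g8, g9, g10, g11, g12, g13, g14, g15, g16]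
  ring

theorem nor_Rtilde (c : ℝ) : S.nor x (S.Rtilde c x (S.ι x b) (S.ι x a) (S.ι x a)) =
    (-(3 * c * S.sinhAngle a b)) • S.F x a := by
  obtain ⟨g1, g2, g3, g4, g5, g6, g7, g8, g9, g10, g11, g12, g13, g14, g15, g16⟩ := hab.gram
  have : S.Rtilde c x (S.ι x b) (S.ι x a) (S.ι x a) =
      S.ι x (c • a) + (-(3 * c * S.sinhAngle a b)) • S.J x (S.ι x a) := by
    simp only [Rtilde, g1, g3, g7, g9, g11, map_smul]
    module
  rw [this, nor_add, nor_ι, nor_smul, zero_add, F]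

/-- On a plane a tensor with these skew symmetries is a product of two determinants times its value
on `(a, b, b, a)`. -/
theorem metric_Rtilde (c : ℝ) (p₁ q₁ p₂ q₂ p₃ q₃ p₄ q₄ : ℝ) :
    S.metric x (S.Rtilde c x (S.ι x (p₁ • a + q₁ • b)) (S.ι x (p₂ • a + q₂ • b))
      (S.ι x (p₃ • a + q₃ • b))) (S.ι x (p₄ • a + q₄ • b)) =
    (p₁ * q₂ - q₁ * p₂) * (p₄ * q₃ - q₄ * p₃) * (c * (3 * S.sinhAngle a b ^ 2 - 1)) := by
  obtain ⟨g1, g2, g3, g4, g5, g6, g7, g8, g9, g10, g11, g12, g13, g14, g15, g16⟩ := hab.gram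
  simp only [Rtilde, map_add, map_sub, map_smul, add_apply, sub_apply, smul_apply, smul_eq_mul,
    g1, g2, g3, g4, g5, g6, g7, g8, g9, g10, g11, g12]
  ring

end IsNullPair

theorem sinh_wirtingerAngle (e₁ e₂ : ∀ x : M, TangentSpace (𝓡 2) x) (x : M) :
    Real.sinh (S.wirtingerAngle e₁ e₂ x) = S.sinhAngle (e₁ x) (e₂ x) := by
  rw [wirtingerAngle, Real.sinh_arsinh, P, g_tang, sinhAngle]

/-- A basis tensored with its dual basis is the inverse metric; this makes the trace in
`meanCurvature` computable in any frame. -/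
theorem sum_g_mul_g_dualBasis {x : M} (b : Module.Basis (Fin 2) ℝ (TangentSpace (𝓡 2) x))
    (u v : TangentSpace (𝓡 2) x) :
    ∑ i, S.g x (b i) u * S.g x ((S.g x).dualBasis (S.g_nondegenerate x) b i) v = S.g x u v := by
  conv_rhs => rw [← ((S.g x).dualBasis (S.g_nondegenerate x) b).sum_repr u]
  simp [LinearMap.BilinForm.dualBasis_repr_apply, S.g_symm u]

/-- The mean curvature vector in terms of a pseudo-orthonormal frame. -/
theorem IsNullPair.meanCurvature_eq {x : M} {A B : ∀ x : M, TangentSpace (𝓡 2) x}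
    (hab : S.IsNullPair (A x) (B x)) (hA : DiffFieldAt A x) (hB : DiffFieldAt B x) :
    S.meanCurvature x = -S.h A B x := by
  set b : Module.Basis (Fin 2) ℝ (TangentSpace (𝓡 2) x) :=
    (EuclideanSpace.basisFun (Fin 2) ℝ).toBasis
  set b' := (S.g x).dualBasis (S.g_nondegenerate x) b with hb'
  have hi : ∀ i, S.h (FiberBundle.extend (EuclideanSpace ℝ (Fin 2)) (b i))
      (FiberBundle.extend (EuclideanSpace ℝ (Fin 2)) (b' i)) x =
      (S.g x (b i) (B x) * S.g x (b' i) (B x)) • S.h A A x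
      + (S.g x (b i) (B x) * S.g x (b' i) (A x) + S.g x (b i) (A x) * S.g x (b' i) (B x)) •
        S.h A B x
      + (S.g x (b i) (A x) * S.g x (b' i) (A x)) • S.h B B x := fun i ↦ by
    rw [S.h_combination hA hB (FiberBundle.mdifferentiableAt_extend ..)
      (by rw [FiberBundle.extend_apply_self]; exact hab.eq_combination (b i))
      (by rw [FiberBundle.extend_apply_self]; exact hab.eq_combination (b' i))]
    simp only [neg_mul_neg]
  change (1 / 2 : ℝ) • ∑ i, S.h (FiberBundle.extend (EuclideanSpace ℝ (Fin 2)) (b i))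
    (FiberBundle.extend (EuclideanSpace ℝ (Fin 2)) (b' i)) x = _
  -- After contraction the coefficients of `h(A,A)`, `h(A,B)`, `h(B,B)` are `g(B,B) = 0`, `2 g(A,B)
  -- = -2` and `g(A,A) = 0`.
  simp only [hi, Finset.sum_add_distrib, ← Finset.sum_smul]
  simp only [hb', S.sum_g_mul_g_dualBasis, hab.null_fst, hab.null_snd, hab.pairing, hab.pairing']
  module

theorem conn_eq_zero {x : M} {σ : ∀ x, E x} (h : ∀ᶠ y in 𝓝 x, σ y = 0) : S.conn σ x = 0 := by
  rw [← S.conn_congr (σ := 0) (mdifferentiableAt_zeroSection ..) (by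
    filter_upwards [h] with y hy; rw [hy]; rfl)]
  simp

/-! ### Parallel null frames and the derivatives of the Wirtinger angle. -/

namespace IsParallelNullFrame

variable {U : Set M} {e₁ e₂ : ∀ x : M, TangentSpace (𝓡 2) x}
  (he : S.IsParallelNullFrame U e₁ e₂)
include he

theorem isNullPair {x : M} (hx : x ∈ U) : S.IsNullPair (e₁ x) (e₂ x) :=
  ⟨he.null_fst x hx, he.null_snd x hx, he.pairing x hx⟩

theorem diffFieldAt_fst {x : M} (hx : x ∈ U) : DiffFieldAt e₁ x :=
  he.contMDiffOn_fst.diffFieldAt he.isOpen hx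

theorem diffFieldAt_snd {x : M} (hx : x ∈ U) : DiffFieldAt e₂ x :=
  he.contMDiffOn_snd.diffFieldAt he.isOpen hx

theorem contMDiffOn_sinhAngle :
    ContMDiffOn (𝓡 2) 𝓘(ℝ, ℝ) ∞ (fun y ↦ S.sinhAngle (e₁ y) (e₂ y)) U :=
  (S.contMDiffOn_metric
    (ContMDiffOn.clm_bundle_apply S.J_contMDiff.contMDiffOn
      (ContMDiffOn.clm_bundle_apply S.ι_contMDiff.contMDiffOn he.contMDiffOn_fst))
    (ContMDiffOn.clm_bundle_apply S.ι_contMDiff.contMDiffOn he.contMDiffOn_snd)).neg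

theorem contMDiffOn_wirtingerAngle :
    ContMDiffOn (𝓡 2) 𝓘(ℝ, ℝ) ∞ (S.wirtingerAngle e₁ e₂) U := by
  refine (Real.contDiff_arsinh.contMDiff.comp_contMDiffOn he.contMDiffOn_sinhAngle).congr
    fun y _ ↦ ?_
  rw [Function.comp_apply, ← sinh_wirtingerAngle, Real.arsinh_sinh]

theorem mdifferentiableAt_wirtingerAngle {x : M} (hx : x ∈ U) :
    MDifferentiableAt (𝓡 2) 𝓘(ℝ, ℝ) (S.wirtingerAngle e₁ e₂) x :=
  (he.contMDiffOn_wirtingerAngle.contMDiffAt (he.isOpen.mem_nhds hx)).mdifferentiableAt (by simp)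

theorem conn_fst {x : M} (hx : x ∈ U) (X : ∀ x : M, TangentSpace (𝓡 2) x) :
    S.conn (fun y ↦ S.ι y (e₁ y)) x (X x) = S.h X e₁ x := by
  rw [← ι_nabla_add_h, he.parallel_fst x hx, map_zero, zero_add]

theorem conn_snd {x : M} (hx : x ∈ U) (X : ∀ x : M, TangentSpace (𝓡 2) x) :
    S.conn (fun y ↦ S.ι y (e₂ y)) x (X x) = S.h X e₂ x := by
  rw [← ι_nabla_add_h, he.parallel_snd x hx, map_zero, zero_add]

/-- Differentiate `-⟨Je₁, e₂⟩`: `J` is parallel, and since the frame is parallel only `h` survives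
in the formula of Gauss. -/
theorem dirDeriv_sinhAngle {x : M} (hx : x ∈ U) (X : ∀ x : M, TangentSpace (𝓡 2) x) :
    dirDeriv X (fun y ↦ S.sinhAngle (e₁ y) (e₂ y)) x =
      S.metric x (S.h X e₁ x) (S.J x (S.ι x (e₂ x)))
        - S.metric x (S.h X e₂ x) (S.J x (S.ι x (e₁ x))) := by
  have d₁ := S.diffSecAt_ι (he.diffFieldAt_fst hx)
  have d₂ := S.diffSecAt_ι (he.diffFieldAt_snd hx)
  have h := S.dirDeriv_metric (X := X) (S.diffSecAt_J d₁) d₂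
  rw [S.conn_J x _ d₁, he.conn_fst hx, he.conn_snd hx, metric_J_left,
    S.metric_symm x _ (S.h X e₂ x)] at h
  have hn : dirDeriv X (fun y ↦ S.sinhAngle (e₁ y) (e₂ y)) x =
      -dirDeriv X (fun y ↦ S.metric y (S.J y (S.ι y (e₁ y))) (S.ι y (e₂ y))) x := by
    rw [dirDeriv, dirDeriv]
    simp only [sinhAngle]
    rw [mvfderiv_fun_neg]
    rfl
  rw [hn, h]
  ring

theorem cosh_mul_dirDeriv {x : M} (hx : x ∈ U) (X : ∀ x : M, TangentSpace (𝓡 2) x) :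
    Real.cosh (S.wirtingerAngle e₁ e₂ x) * dirDeriv X (S.wirtingerAngle e₁ e₂) x =
      S.metric x (S.h X e₁ x) (S.J x (S.ι x (e₂ x)))
        - S.metric x (S.h X e₂ x) (S.J x (S.ι x (e₁ x))) := by
  rw [← he.dirDeriv_sinhAngle hx, ← dirDeriv_comp (Real.hasDerivAt_sinh _)
    (he.mdifferentiableAt_wirtingerAngle hx)]
  simp only [sinh_wirtingerAngle]

/-! ### Minimal surfaces: the second fundamental form, Gauss and Codazzi. -/

section Minimal

variable (hmin : S.IsMinimal)
include hmin

theorem h_fst_snd {x : M} (hx : x ∈ U) : S.h e₁ e₂ x = 0 := by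
  rw [← neg_eq_zero, ← (he.isNullPair hx).meanCurvature_eq (he.diffFieldAt_fst hx)
    (he.diffFieldAt_snd hx), hmin x]

theorem h_snd_fst {x : M} (hx : x ∈ U) : S.h e₂ e₁ x = 0 := by
  rw [S.h_symm (he.diffFieldAt_snd hx) (he.diffFieldAt_fst hx), he.h_fst_snd hmin hx]

theorem cosh_mul_dirDeriv_fst {x : M} (hx : x ∈ U) :
    Real.cosh (S.wirtingerAngle e₁ e₂ x) * dirDeriv e₁ (S.wirtingerAngle e₁ e₂) x =
      S.metric x (S.h e₁ e₁ x) (S.J x (S.ι x (e₂ x))) := by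
  rw [he.cosh_mul_dirDeriv hx, he.h_fst_snd hmin hx]; simp

theorem cosh_mul_dirDeriv_snd {x : M} (hx : x ∈ U) :
    Real.cosh (S.wirtingerAngle e₁ e₂ x) * dirDeriv e₂ (S.wirtingerAngle e₁ e₂) x =
      -S.metric x (S.h e₂ e₂ x) (S.J x (S.ι x (e₁ x))) := by
  rw [he.cosh_mul_dirDeriv hx, he.h_snd_fst hmin hx]; simp

/-- The `e₃` coefficient is read from the product with `Je₂`, which minimality identifies with `cosh
α · α_x`; this is `β = -α_x`. -/
theorem h_fst_fst {x : M} (hx : x ∈ U) :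
    S.h e₁ e₁ x = (-dirDeriv e₁ (S.wirtingerAngle e₁ e₂) x) •
        S.adaptedNormal (S.wirtingerAngle e₁ e₂) e₁ x +
      (-(S.metric x (S.h e₁ e₁ x) (S.J x (S.ι x (e₁ x))) /
          Real.cosh (S.wirtingerAngle e₁ e₂ x))) •
        S.adaptedNormal (S.wirtingerAngle e₁ e₂) e₂ x := by
  have hC := (Real.cosh_pos (S.wirtingerAngle e₁ e₂ x)).ne'
  conv_lhs => rw [(he.isNullPair hx).eq_combination_F (w := S.h e₁ e₁ x) fun u ↦ S.metric_h_ι u]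
  rw [← he.cosh_mul_dirDeriv_fst hmin hx, ← sinh_wirtingerAngle, add_comm (1 : ℝ),
    ← Real.cosh_sq, adaptedNormal, adaptedNormal, smul_smul, smul_smul]
  congr 2 <;> field_simp

theorem h_snd_snd {x : M} (hx : x ∈ U) :
    S.h e₂ e₂ x = (-(S.metric x (S.h e₂ e₂ x) (S.J x (S.ι x (e₂ x))) /
          Real.cosh (S.wirtingerAngle e₁ e₂ x))) •
        S.adaptedNormal (S.wirtingerAngle e₁ e₂) e₁ x +
      dirDeriv e₂ (S.wirtingerAngle e₁ e₂) x •
        S.adaptedNormal (S.wirtingerAngle e₁ e₂) e₂ x := by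
  have hC := (Real.cosh_pos (S.wirtingerAngle e₁ e₂ x)).ne'
  conv_lhs => rw [(he.isNullPair hx).eq_combination_F (w := S.h e₂ e₂ x) fun u ↦ S.metric_h_ι u]
  rw [← neg_eq_iff_eq_neg.2 (he.cosh_mul_dirDeriv_snd hmin hx), ← sinh_wirtingerAngle,
    add_comm (1 : ℝ), ← Real.cosh_sq, adaptedNormal, adaptedNormal, smul_smul, smul_smul]
  congr 2 <;> field_simp

/-- The equation of Gauss for a flat minimal surface. -/
theorem gaussAt_iff [T2Space M] (hflat : S.IsFlat) (c : ℝ) {x : M} (hx : x ∈ U) :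
    S.GaussAt c x ↔ c * (3 * S.sinhAngle (e₁ x) (e₂ x) ^ 2 - 1)
      + S.metric x (S.h e₁ e₁ x) (S.h e₂ e₂ x) = 0 := by
  have hab := he.isNullPair hx
  have h0 := he.h_fst_snd hmin hx
  have hh : ∀ {X Y : ∀ x : M, TangentSpace (𝓡 2) x} {p q r t : ℝ}, DiffFieldAt Y x →
      X x = p • e₁ x + q • e₂ x → Y x = r • e₁ x + t • e₂ x →
      S.h X Y x = (p * r) • S.h e₁ e₁ x + (q * t) • S.h e₂ e₂ x := fun hY hXx hYx ↦ by
    rw [S.h_combination (he.diffFieldAt_fst hx) (he.diffFieldAt_snd hx) hY hXx hYx, h0]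
    simp
  -- As `h(e₁, e₂) = 0`, the whole right-hand side of Gauss is two determinants times one scalar. On
  -- `(e₁, e₂, e₂, e₁)` the determinants are `1`, which gives the converse.
  have key : ∀ {X Y Z W : ∀ x : M, TangentSpace (𝓡 2) x} {p₁ q₁ p₂ q₂ p₃ q₃ p₄ q₄ : ℝ},
      DiffFieldAt Z x → DiffFieldAt W x →
      X x = p₁ • e₁ x + q₁ • e₂ x → Y x = p₂ • e₁ x + q₂ • e₂ x →
      Z x = p₃ • e₁ x + q₃ • e₂ x → W x = p₄ • e₁ x + q₄ • e₂ x →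
      S.metric x (S.Rtilde c x (S.ι x (X x)) (S.ι x (Y x)) (S.ι x (Z x))) (S.ι x (W x))
        + S.metric x (S.h X W x) (S.h Y Z x) - S.metric x (S.h X Z x) (S.h Y W x) =
      (p₁ * q₂ - q₁ * p₂) * (p₄ * q₃ - q₄ * p₃) *
        (c * (3 * S.sinhAngle (e₁ x) (e₂ x) ^ 2 - 1)
          + S.metric x (S.h e₁ e₁ x) (S.h e₂ e₂ x)) := by
    intro X Y Z W p₁ q₁ p₂ q₂ p₃ q₃ p₄ q₄ dZ dW hX hY hZ hW
    rw [hh dW hX hW, hh dZ hY hZ, hh dZ hX hZ, hh dW hY hW, hX, hY, hZ, hW,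
      hab.metric_Rtilde c]
    simp only [map_add, map_smul, add_apply, smul_apply, smul_eq_mul,
      S.metric_symm x (S.h e₂ e₂ x) (S.h e₁ e₁ x)]
    ring
  constructor
  · intro hG
    obtain ⟨A, hA, hAx⟩ := exists_smoothField_apply_eq (e₁ x)
    obtain ⟨B, hB, hBx⟩ := exists_smoothField_apply_eq (e₂ x)
    have h := hG A B B A hA hB hB hA
    rw [hflat A B B hA hB hB x, map_zero, LinearMap.zero_apply,
      key (p₁ := 1) (q₁ := 0) (p₂ := 0) (q₂ := 1) (p₃ := 0) (q₃ := 1) (p₄ := 1) (q₄ := 0)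
        (hB.diffFieldAt x) (hA.diffFieldAt x) (by simp [hAx]) (by simp [hBx])
        (by simp [hBx]) (by simp [hAx])] at h
    linarith
  · intro hG X Y Z W hX hY hZ hW
    rw [hflat X Y Z hX hY hZ x, map_zero, LinearMap.zero_apply,
      key (hZ.diffFieldAt x) (hW.diffFieldAt x) (hab.eq_combination _) (hab.eq_combination _)
        (hab.eq_combination _) (hab.eq_combination _), hG, mul_zero]

/-- Near a point, `h(e₁, e₁)` is the restriction of a global normal section, whose normal
derivative along `e₂` is given by the equation of Codazzi. -/
theorem exists_normal_germ [T2Space M] {x : M} (hx : x ∈ U) :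
    ∃ n : ∀ x, E x, S.IsNormal n ∧ DiffSecAt n x ∧ (∀ᶠ y in 𝓝 x, n y = S.h e₁ e₁ y) ∧
      ∀ c, S.CodazziAt c x → S.nor x (S.conn n x (e₂ x)) =
        (-(3 * c * S.sinhAngle (e₁ x) (e₂ x))) • S.F x (e₁ x) := by
  -- The Codazzi hypothesis speaks of global smooth fields, so the frame is replaced by global
  -- fields with the same germs at `x`.
  obtain ⟨A, hA, hAe⟩ := he.contMDiffOn_fst.exists_smoothField_eventuallyEq he.isOpen hx
  obtain ⟨B, hB, hBe⟩ := he.contMDiffOn_snd.exists_smoothField_eventuallyEq he.isOpen hx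
  have hU : ∀ᶠ y in 𝓝 x, y ∈ U := he.isOpen.mem_nhds hx
  have hconn : ∀ᶠ y in 𝓝 x,
      S.conn (fun z ↦ S.ι z (A z)) y = S.conn (fun z ↦ S.ι z (e₁ z)) y := by
    filter_upwards [hAe.eventually_nhds] with y hy
    exact S.conn_congr ((S.smoothSec_ι hA).diffSecAt y)
      (by filter_upwards [hy] with z hz; rw [hz])
  have hconn' : ∀ᶠ y in 𝓝 x,
      S.conn (fun z ↦ S.ι z (B z)) y = S.conn (fun z ↦ S.ι z (e₂ z)) y := by
    filter_upwards [hBe.eventually_nhds] with y hy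
    exact S.conn_congr ((S.smoothSec_ι hB).diffSecAt y)
      (by filter_upwards [hy] with z hz; rw [hz])
  have hn : ∀ᶠ y in 𝓝 x, S.h A A y = S.h e₁ e₁ y := by
    filter_upwards [hconn, hAe] with y hy hAy
    rw [h, h, hy, hAy]
  have hBA : ∀ᶠ y in 𝓝 x, S.h B A y = 0 := by
    filter_upwards [hconn, hBe, hU] with y hy hBy hyU
    rw [← he.h_snd_fst hmin hyU, h, h, hy, hBy]
  have hnabla : ∀ᶠ y in 𝓝 x, ∀ u, S.nabla A y u = 0 := by
    filter_upwards [hconn, hU] with y hy hyU u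
    rw [← he.parallel_fst y hyU u, nabla, nabla, hy]
  have hnabla' : ∀ᶠ y in 𝓝 x, ∀ u, S.nabla B y u = 0 := by
    filter_upwards [hconn', hU] with y hy hyU u
    rw [← he.parallel_snd y hyU u, nabla, nabla, hy]
  refine ⟨S.h A A, fun y u ↦ S.metric_h_ι u, S.diffSecAt_h hA hA, hn, fun c hC ↦ ?_⟩
  have h0 : S.nor x 0 = 0 := by simpa using S.nor_smul (0 : ℝ) (0 : E x)
  -- The second slot of `h` is differentiated, so vanishing near `x` is needed here; in the first
  -- slot vanishing at `x` suffices.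
  have hparallel : ∀ {X Y : ∀ x : M, TangentSpace (𝓡 2) x},
      S.h X (fun y ↦ S.nabla A y (Y y)) x = 0 := fun {X Y} ↦ by
    rw [h, conn_eq_zero (by filter_upwards [hnabla] with y hy; rw [hy, map_zero])]
    exact h0
  have hparallel' : ∀ {X Y : ∀ x : M, TangentSpace (𝓡 2) x}, (∀ u, S.nabla Y x u = 0) →
      S.h (fun y ↦ S.nabla Y y (X y)) A x = 0 := fun {X Y} hY ↦ by
    rw [h, hY, map_zero, h0]
  have hD : S.normalConn (S.h B A) x (A x) = 0 := by
    rw [normalConn, conn_eq_zero hBA]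
    exact h0
  -- For the triple `(e₂, e₁, e₁)` every term except `D_{e₂} h(e₁, e₁)` vanishes.
  have h := hC B A A hB hA hA
  rw [nablaBarH, nablaBarH, hparallel, hparallel, hparallel' hnabla.self_of_nhds,
    hparallel' hnabla'.self_of_nhds, hD, hAe.self_of_nhds, hBe.self_of_nhds,
    (he.isNullPair hx).nor_Rtilde c] at h
  simpa [normalConn] using h.symm

/-- The second derivative of the Wirtinger angle of a minimal surface. -/
theorem dirDeriv_dirDeriv [T2Space M] {c : ℝ} {x : M} (hx : x ∈ U) (hC : S.CodazziAt c x) :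
    dirDeriv e₂ (dirDeriv e₁ (S.wirtingerAngle e₁ e₂)) x =
      dirDeriv e₁ (S.wirtingerAngle e₁ e₂) x * dirDeriv e₂ (S.wirtingerAngle e₁ e₂) x *
        Real.tanh (S.wirtingerAngle e₁ e₂ x)
      + 3 * c * Real.sinh (S.wirtingerAngle e₁ e₂ x) *
        Real.cosh (S.wirtingerAngle e₁ e₂ x) := by
  obtain ⟨n, hn, dn, hne, hcod⟩ := he.exists_normal_germ hmin hx
  have hab := he.isNullPair hx
  have hU : ∀ᶠ y in 𝓝 x, y ∈ U := he.isOpen.mem_nhds hx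
  have d₂ := S.diffSecAt_ι (he.diffFieldAt_snd hx)
  have dα := he.mdifferentiableAt_wirtingerAngle hx
  have h11 := he.h_fst_fst hmin hx
  have h22 := he.h_snd_snd hmin hx
  set α := S.wirtingerAngle e₁ e₂
  set γ := -(S.metric x (S.h e₁ e₁ x) (S.J x (S.ι x (e₁ x))) / Real.cosh (α x))
  set l := -(S.metric x (S.h e₂ e₂ x) (S.J x (S.ι x (e₂ x))) / Real.cosh (α x))
  -- The product `γ * l` will cancel, so the values are irrelevant and only the expansions `h11`,
  -- `h22` matter.
  clear_value γ l
  have hCpos := (Real.cosh_pos (α x)).ne'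
  have hs : S.sinhAngle (e₁ x) (e₂ x) = Real.sinh (α x) := (sinh_wirtingerAngle _ _ x).symm
  have hsx : ∀ᶠ y in 𝓝 x, Real.cosh (α y) * dirDeriv e₁ α y =
      S.metric y (n y) (S.J y (S.ι y (e₂ y))) := by
    filter_upwards [hne, hU] with y hy hyU
    rw [he.cosh_mul_dirDeriv_fst hmin hyU, hy]
  have dsx := S.mdifferentiableAt_metric dn (S.diffSecAt_J d₂)
  have dcosh : MDifferentiableAt (𝓡 2) 𝓘(ℝ, ℝ) (fun y ↦ Real.cosh (α y)) x :=
    (Real.differentiable_cosh _).mdifferentiableAt.comp x dα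
  have dinv : MDifferentiableAt (𝓡 2) 𝓘(ℝ, ℝ) (fun y ↦ (Real.cosh (α y))⁻¹) x :=
    ((Real.differentiable_cosh _).inv hCpos).mdifferentiableAt.comp x dα
  have dαx : MDifferentiableAt (𝓡 2) 𝓘(ℝ, ℝ) (dirDeriv e₁ α) x := by
    refine (dinv.mul dsx).congr_of_eventuallyEq ?_
    filter_upwards [hsx] with y hy
    have := (Real.cosh_pos (α y)).ne'
    rw [Pi.mul_apply, ← hy]
    field_simp
  -- Differentiate `cosh α · α_x = ⟨n, Je₂⟩` along `e₂` in two ways.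
  have hprod := dirDeriv_mul (X := e₂) dcosh dαx
  rw [dirDeriv_congr hsx, S.dirDeriv_metric dn (S.diffSecAt_J d₂), S.conn_J x _ d₂,
    he.conn_snd hx, dirDeriv_comp (Real.hasDerivAt_cosh _) dα] at hprod
  have hcod' := hcod c hC
  have htan := S.metric_conn_normal_eq_h (X := e₂) hn dn (he.diffFieldAt_snd hx)
  have hJ : S.J x (S.ι x (e₂ x)) = S.F x (e₂ x) - Real.sinh (α x) • S.ι x (e₂ x) := by
    rw [hab.F_snd, hs]; simp
  have hnor : S.metric x (S.conn n x (e₂ x)) (S.F x (e₂ x)) =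
      3 * c * Real.sinh (α x) * Real.cosh (α x) ^ 2 := by
    rw [← S.metric_nor_left_of_normal (n := S.F x (e₂ x)) (fun u ↦ S.metric_nor_ι x _ u), hcod']
    have := hab.metric_combination_F (-(3 * c * Real.sinh (α x))) 0 0 1
    simp only [zero_smul, add_zero, one_smul, zero_add] at this
    rw [hs, this, hs, Real.cosh_sq]
    ring
  have hnx : n x = S.h e₁ e₁ x := hne.self_of_nhds
  simp only [adaptedNormal, smul_smul] at h11 h22
  -- The tangential part of `Je₂` contributes `-sinh α (βμ + γλ)` and `⟨n, J h(e₂,e₂)⟩` contributes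
  -- `sinh α (γλ - βμ)`. Their sum is `2 sinh α · α_x α_y`, one half of which the product rule on
  -- the left absorbs.
  rw [hJ, map_sub, map_smul, hnor, htan, hnx, h11, h22, hab.metric_combination_F,
    hab.metric_combination_F_J, hs, add_comm (1 : ℝ), ← Real.cosh_sq] at hprod
  rw [Real.tanh_eq_sinh_div_cosh]
  simp only [smul_eq_mul] at hprod
  field_simp at hprod ⊢
  linarith

end Minimal

end IsParallelNullFrame

end LorentzianSurface

theorem theorem4p1
    {M : Type*} [TopologicalSpace M] [T2Space M] [ChartedSpace (EuclideanSpace ℝ (Fin 2)) M]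
    [IsManifold (𝓡 2) ∞ M]
    {E : M → Type*} [TopologicalSpace (TotalSpace R4 E)] [∀ x, AddCommGroup (E x)]
    [∀ x, Module ℝ (E x)] [∀ x, TopologicalSpace (E x)] [∀ x, IsTopologicalAddGroup (E x)]
    [∀ x, ContinuousSMul ℝ (E x)] [FiberBundle R4 E] [VectorBundle ℝ R4 E]
    [ContMDiffVectorBundle ∞ R4 E (𝓡 2)]
    (S : LorentzianSurface M E) (c : ℝ) (hmin : S.IsMinimal) (hflat : S.IsFlat) :
    (∀ x, S.GaussAt c x → S.CodazziAt c x → S.RicciAt c x) ∧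
    ∀ (U : Set M) (e₁ e₂ : ∀ x : M, TangentSpace (𝓡 2) x), S.IsParallelNullFrame U e₁ e₂ →
      ∀ α : M → ℝ, α = S.wirtingerAngle e₁ e₂ →
      ContMDiffOn (𝓡 2) 𝓘(ℝ, ℝ) ∞ α U ∧
      (∀ x ∈ U, S.P x (e₁ x) = Real.sinh (α x) • e₁ x ∧
        S.P x (e₂ x) = -(Real.sinh (α x) • e₂ x)) ∧
      ∃ β γ lam μ : M → ℝ,
        (∀ x ∈ U,
          S.h e₁ e₁ x = β x • S.adaptedNormal α e₁ x + γ x • S.adaptedNormal α e₂ x ∧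
          S.h e₁ e₂ x = 0 ∧
          S.h e₂ e₂ x = lam x • S.adaptedNormal α e₁ x + μ x • S.adaptedNormal α e₂ x) ∧
        (∀ x ∈ U, S.CodazziAt c x →
          dirDeriv e₂ (dirDeriv e₁ α) x =
            dirDeriv e₁ α x * dirDeriv e₂ α x * Real.tanh (α x)
              + 3 * c * Real.sinh (α x) * Real.cosh (α x)) ∧
        (∀ x ∈ U, S.GaussAt c x ↔
          γ x * lam x = dirDeriv e₁ α x * dirDeriv e₂ α x
            + c * (3 * Real.sinh (α x) ^ 2 - 1)) := by
  refine ⟨fun x hG hC ↦ S.RicciAt_of_GaussAt_of_CodazziAt hG hC, ?_⟩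
  rintro U e₁ e₂ he α rfl
  refine ⟨he.contMDiffOn_wirtingerAngle, fun x hx ↦ ?_,
    -- Since `e₃, e₄` are null with product `-1`, the coefficients are `γ = -⟨h(e₁,e₁), e₃⟩` and `λ
    -- = -⟨h(e₂,e₂), e₄⟩`; on normal vectors `e₃, e₄` may be replaced by `sech α` times `Je₁, Je₂`.
    fun x ↦ -dirDeriv e₁ (S.wirtingerAngle e₁ e₂) x,
    fun x ↦ -(S.metric x (S.h e₁ e₁ x) (S.J x (S.ι x (e₁ x))) /
      Real.cosh (S.wirtingerAngle e₁ e₂ x)),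
    fun x ↦ -(S.metric x (S.h e₂ e₂ x) (S.J x (S.ι x (e₂ x))) /
      Real.cosh (S.wirtingerAngle e₁ e₂ x)),
    dirDeriv e₂ (S.wirtingerAngle e₁ e₂), fun x hx ↦ ?_, fun x hx hC ↦ ?_, fun x hx ↦ ?_⟩
  · rw [LorentzianSurface.sinh_wirtingerAngle]
    exact ⟨(he.isNullPair hx).P_fst, (he.isNullPair hx).P_snd⟩
  · exact ⟨he.h_fst_fst hmin hx, he.h_fst_snd hmin hx, he.h_snd_snd hmin hx⟩
  · exact he.dirDeriv_dirDeriv hmin hx hC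
  · have h11 := he.h_fst_fst hmin hx
    have h22 := he.h_snd_snd hmin hx
    rw [he.gaussAt_iff hmin hflat c hx]
    beta_reduce
    set γ := -(S.metric x (S.h e₁ e₁ x) (S.J x (S.ι x (e₁ x))) /
      Real.cosh (S.wirtingerAngle e₁ e₂ x))
    set l := -(S.metric x (S.h e₂ e₂ x) (S.J x (S.ι x (e₂ x))) /
      Real.cosh (S.wirtingerAngle e₁ e₂ x))
    clear_value γ l
    have hC := (Real.cosh_pos (S.wirtingerAngle e₁ e₂ x)).ne'
    simp only [LorentzianSurface.adaptedNormal, smul_smul] at h11 h22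
    have hk : S.metric x (S.h e₁ e₁ x) (S.h e₂ e₂ x) =
        dirDeriv e₁ (S.wirtingerAngle e₁ e₂) x * dirDeriv e₂ (S.wirtingerAngle e₁ e₂) x
          - γ * l := by
      rw [h11, h22, (he.isNullPair hx).metric_combination_F,
        ← LorentzianSurface.sinh_wirtingerAngle, add_comm (1 : ℝ), ← Real.cosh_sq]
      field_simp
      ring
    rw [hk, ← LorentzianSurface.sinh_wirtingerAngle]
    constructor <;> intro h <;> linarith
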